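/- **Setting.** Particles: start from a polynomial $P\in\mathbb C[z_1,\dots,z_N]$ whose variables are particles of type $1$. A configuration is a set partition of $\{1,\dots,N\}$; each block is a particle, its type is the size of the block, and an $a$-type particle is written $z^{(a)}$. A fusion passes from a configuration to a coarser one (several blocks may be formed at once): if old particles $z_1,\dots,z_t$ of types $b_1,\dots,b_t$ merge into a particle $z$, substitute $z_i=z+\lambda\xi_i$ with $\sum_i b_i\xi_i=0$ (the same $\lambda$ for all merged blocks) and expand in $\lambda$. If the coefficient of the lowest power of $\lambda$ that is not identically zero equals $R(\xi)\,P_{\rm der}(\text{new particles})$ for polynomials $R,P_{\rm der}$, then $P_{\rm der}$ is the derived polynomial, unique up to a nonzero scalar. A fusion process is a finite sequence of fusions, each applied to the previous derived polynomial, starting from $P$. $P$ is *sUFC* if it is symmetric, every fusion process can be carried out on it, and two processes with the same final configuration give the same derived polynomial up to a nonzero scalar. It is *ULC* if for all $a,b$ there is a number $D_{a,b}$ such that in every derived polynomial ($P$ included) the exact order of divisibility by $z^{(a)}-z^{(b)}$ is $D_{a,b}$, for any $a$-type and any other $b$-type particle in it. Let $S_a$ ($0\le a\le N$) be the least total degree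 of $a$ of the variables among the monomials of $P$, let $d$ be the highest degree of a variable $z_i$ in $P$, and let $J_a=\frac{ad}{2}-S_a$. Call $P$ *admissible* if it is sUFC, translation invariant, ULC and homogeneous. $P$ is *AMS* if it is admissible and $J_N=0$. It is *$n$-AMS* if it is AMS, $N>0$, $n\mid N$ and $J_n=\frac12D_{n,1}(N-n)$ (for $N=n$ this reads $J_n=0$). A sequence $(P_k)_{k\ge1}$ of admissible polynomials in $N_k$ variables *has a pattern of zeros* if $S_a$ is the same for all $P_k$ with $N_k\ge a$. It is a *$\nu$-sequence*, $\nu\in\mathbb Q_{>0}$, if moreover $\lim_k N_k/d_k=\nu$, where $d_k$ is the highest degree of a variable in $P_k$. For positive integers $n,m$, $P_k$ *has cluster form $(n,m)$* if, for $\Phi_{1/m}=\prod_{i<j}(z_i-z_j)^m$ in $N_k$ variables and every fusion process, the rational function $P_{k,\rm der}^{\,n}/\Phi_{1/m,\rm der}$ (derived polynomials from that same process) does not depend on any $n$-type particle of the final configuration. An *$n$-CF $\nu$-sequence* is a $\nu$-sequence with $\nu=n/m$ and $N_k=kn$, all of whose members have cluster form $(n,m)$. A *$\nu$-sequence of $n$-AMS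 polynomials* is a sequence of $n$-AMS polynomials $P_k$, not all constant, with $N_k\to\infty$, that has a pattern of zeros; nothing is required of its filling fraction. **Theorem 6.3.** (1) Let $(P_k)$ be a $\nu$-sequence of $n$-AMS polynomials. Then there is an integer $m>0$ with $D_{n,1}=m$ for every $P_k$ (with $N_k>n$), the sequence is a $\nu$-sequence with $\nu=\lim_k N_k/d_k=n/m$, and every $P_k$ has cluster form $(n,m)$. In particular, if $N_k=kn$, it is an $n$-CF $\nu$-sequence with $\nu=n/m$. (2) For such a sequence, $S_a=S_{n-a}-\frac{n-2a}{n}S_n$ for all $0\le a\le n$. (3) Conversely, if $(P_k)$ is an $n$-CF $\nu$-sequence with $\nu=n/m$, then every $P_k$ that is AMS is $n$-AMS, with $D_{n,1}=m$ (whenever $N_k>n$). -/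

import Mathlib

namespace PatternOfZeros

open MvPolynomial Filter Topology

/-! ### Particles, fusions, derived polynomials

A configuration of particles obtained from `N` particles of type `1` is an equivalence relation
`r` on `Fin N`: every class `x : Quotient r` is one particle, and its type is the number of original
particles clustered in it. -/

/-- The type `a` of a particle `z^(a)`. -/
noncomputable def particleType {N : ℕ} {r : Setoid (Fin N)} (x : Quotient r) : ℕ :=
  {i : Fin N | Quotient.mk r i = x}.ncard

/-- In a fusion `r ≤ s` every particle of `r` goes into a particle of `s`. -/
def fuseMap {N : ℕ} {r s : Setoid (Fin N)} (h : r ≤ s) : Quotient r → Quotient s :=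
  Quotient.map' id h

open Classical in
/-- The centre-of-mass condition: for every new particle `y`, the sum of `(type of x) * ξ x` over
the old particles `x` fused into `y` vanishes. The sum is written over the original particles
in `y`, so that each `x` is counted as often as its type says. -/
def IsCentered {N : ℕ} {r : Setoid (Fin N)} (s : Setoid (Fin N)) (ξ : Quotient r → ℂ) : Prop :=
  ∀ y : Quotient s,
    ∑ i : Fin N, (if Quotient.mk s i = y then ξ (Quotient.mk r i) else 0) = 0

/-- The expansion in powers of `lam` of `Q` after the substitution `z_x = z_y + lam * ξ_x`
for each old particle `x` fused into the new particle `y`. Particles not involved in the fusion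
are classes that do not change; there `ξ` is `0` by the centre-of-mass condition. -/
noncomputable def fusionExpansion {N : ℕ} {r s : Setoid (Fin N)} (h : r ≤ s)
    (Q : MvPolynomial (Quotient r) ℂ) (z : Quotient s → ℂ) (ξ : Quotient r → ℂ) : Polynomial ℂ :=
  aeval (fun x : Quotient r =>
    Polynomial.C (z (fuseMap h x)) + Polynomial.X * Polynomial.C (ξ x)) Q

/-- `Q'` is a derived polynomial of `Q` for the (simultaneous) fusion from `r` to `s`: the lowest
coefficient `Q^d` of the expansion in `lam` that is not identically zero is `R(ξ) Q'(z)`. A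
polynomial in the centered `ξ` is determined by its values at `ξ` whose groups have norm one, so
normalizing the `ξ` makes no difference. -/
def IsDerivedStep {N : ℕ} {r s : Setoid (Fin N)} (h : r ≤ s)
    (Q : MvPolynomial (Quotient r) ℂ) (Q' : MvPolynomial (Quotient s) ℂ) : Prop :=
  ∃ (d : ℕ) (R : MvPolynomial (Quotient r) ℂ),
    (∀ (z : Quotient s → ℂ) (ξ : Quotient r → ℂ), IsCentered s ξ →
      (∀ j < d, (fusionExpansion h Q z ξ).coeff j = 0) ∧
      (fusionExpansion h Q z ξ).coeff d = eval ξ R * eval z Q') ∧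
    ∃ (z : Quotient s → ℂ) (ξ : Quotient r → ℂ), IsCentered s ξ ∧ eval ξ R * eval z Q' ≠ 0

/-- A fusion process, indexed by its final configuration. -/
inductive FusionProcess (N : ℕ) : Setoid (Fin N) → Type
  | start : FusionProcess N ⊥
  | fuse {r : Setoid (Fin N)} (p : FusionProcess N r) (s : Setoid (Fin N)) (h : r ≤ s) :
      FusionProcess N s

/-- `Q` is a derived polynomial of `P` from the fusion process. -/
def FusionProcess.IsDerived {N : ℕ} (P : MvPolynomial (Fin N) ℂ) :
    {r : Setoid (Fin N)} → FusionProcess N r → MvPolynomial (Quotient r) ℂ → Prop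
  | _, .start, Q => Q = rename (Quotient.mk ⊥) P
  | _, .fuse p _ h, Q => ∃ Q₀, p.IsDerived P Q₀ ∧ IsDerivedStep h Q₀ Q

/-! ### Conditions on one polynomial -/

/-- Unique fusion condition: every fusion process can be carried out on `P`, and two processes
with the same final configuration give the same derived polynomial up to a nonzero scalar. -/
def IsUFC {N : ℕ} (P : MvPolynomial (Fin N) ℂ) : Prop :=
  (∀ (r : Setoid (Fin N)) (p : FusionProcess N r), ∃ Q, p.IsDerived P Q) ∧
  ∀ (r : Setoid (Fin N)) (p p' : FusionProcess N r) (Q Q' : MvPolynomial (Quotient r) ℂ),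
    p.IsDerived P Q → p'.IsDerived P Q' → ∃ c : ℂ, c ≠ 0 ∧ Q' = C c * Q

def IsTranslationInvariant {N : ℕ} (P : MvPolynomial (Fin N) ℂ) : Prop :=
  ∀ (c : ℂ) (z : Fin N → ℂ), eval (fun i => z i + c) P = eval z P

/-- `D_{a,b} = d`: in every derived polynomial of `P` (including `P` itself) the exact order of
`z^(a) - z^(b)` is `d`, for every `a`-type and every other `b`-type particle in it. -/
def HasLocalOrder {N : ℕ} (P : MvPolynomial (Fin N) ℂ) (a b d : ℕ) : Prop :=
  ∀ (r : Setoid (Fin N)) (p : FusionProcess N r) (Q : MvPolynomial (Quotient r) ℂ),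
    p.IsDerived P Q → ∀ x y : Quotient r, x ≠ y → particleType x = a → particleType y = b →
      emultiplicity (X x - X y) Q = (d : ℕ∞)

/-- Unique local condition: all the numbers `D_{a,b}` are well defined. -/
def IsULC {N : ℕ} (P : MvPolynomial (Fin N) ℂ) : Prop :=
  ∀ a b : ℕ, ∃ d : ℕ, HasLocalOrder P a b d

/-- Symmetric, UFC, translation invariant, ULC and homogeneous polynomials. -/
structure IsAdmissible {N : ℕ} (P : MvPolynomial (Fin N) ℂ) : Prop where
  symmetric : P.IsSymmetric
  ufc : IsUFC P
  translationInvariant : IsTranslationInvariant P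
  ulc : IsULC P
  homogeneous : ∃ d : ℕ, P.IsHomogeneous d

/-- `S_a`, the least total degree of the first `a` variables among the monomials of `P`; it is meant
for symmetric `P ≠ 0` and `a ≤ N`. -/
noncomputable def S {N : ℕ} (P : MvPolynomial (Fin N) ℂ) (a : ℕ) : ℕ :=
  sInf {t : ℕ | ∃ m ∈ P.support, t = ∑ i : Fin N, if (i : ℕ) < a then m i else 0}

/-- The highest degree of a single variable in `P`. -/
noncomputable def maxDegree {N : ℕ} (P : MvPolynomial (Fin N) ℂ) : ℕ :=
  Finset.univ.sup fun i : Fin N => P.degreeOf i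

/-- The angular momentum `J_a = a J - S_a`, with `J` half of the highest degree of a variable. -/
noncomputable def J {N : ℕ} (P : MvPolynomial (Fin N) ℂ) (a : ℕ) : ℚ :=
  (a : ℚ) * ((maxDegree P : ℚ) / 2) - (S P a : ℚ)

/-- Angular momentum symmetry. -/
structure IsAMS {N : ℕ} (P : MvPolynomial (Fin N) ℂ) : Prop extends IsAdmissible P where
  J_eq_zero : J P N = 0

/-- `n`-AMS polynomials. For `N = n` there is no `D_{n,1}`, and the last
condition only says `J_n = 0`. -/
structure IsNAMS (n : ℕ) {N : ℕ} (P : MvPolynomial (Fin N) ℂ) : Prop extends IsAMS P where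
  pos : 0 < N
  dvd : n ∣ N
  J_eq : ∃ d : ℕ, HasLocalOrder P n 1 d ∧ J P n = 1 / 2 * (d : ℚ) * ((N : ℚ) - (n : ℚ))

/-- The Laughlin state `Φ_{1/m} = ∏_{i<j} (z_i - z_j)^m`. -/
noncomputable def laughlin (N m : ℕ) : MvPolynomial (Fin N) ℂ :=
  ∏ i : Fin N, ∏ j ∈ Finset.Ioi i, (X i - X j) ^ m

/-- The rational function `g` does not depend on the variable `x`. -/
def IsIndependentOf {σ : Type} (g : FractionRing (MvPolynomial σ ℂ)) (x : σ) : Prop :=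
  ∃ A B : MvPolynomial σ ℂ, x ∉ A.vars ∧ x ∉ B.vars ∧ B ≠ 0 ∧
    g = algebraMap _ _ A / algebraMap _ _ B

/-- The cluster form of one polynomial: with `G = P^n / Φ_{1/m}`, every derived
`G_der = P_der^n / Φ_der` (the same fusion process for both) is independent of
every `n`-type particle. -/
def HasClusterForm (n m : ℕ) {N : ℕ} (P : MvPolynomial (Fin N) ℂ) : Prop :=
  ∀ (r : Setoid (Fin N)) (p : FusionProcess N r) (Q F : MvPolynomial (Quotient r) ℂ),
    p.IsDerived P Q → p.IsDerived (laughlin N m) F →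
    ∀ x : Quotient r, particleType x = n →
      IsIndependentOf
        ((algebraMap _ (FractionRing (MvPolynomial (Quotient r) ℂ)) Q) ^ n / algebraMap _ _ F) x

/-! ### Sequences of polynomials -/

/-- A pattern of zeros is associated to the sequence: `S_a` is the same for all `P_k` with
`N_k ≥ a`. -/
def HasPatternOfZeros (N : ℕ → ℕ) (P : ∀ k, MvPolynomial (Fin (N k)) ℂ) : Prop :=
  ∀ a k l : ℕ, a ≤ N k → a ≤ N l → S (P k) a = S (P l) a

structure IsNuSequence (ν : ℚ) (N : ℕ → ℕ) (P : ∀ k, MvPolynomial (Fin (N k)) ℂ) : Prop where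
  admissible : ∀ k, IsAdmissible (P k)
  pos : 0 < ν
  filling : Tendsto (fun k => (N k : ℝ) / (maxDegree (P k) : ℝ)) atTop (𝓝 (ν : ℝ))
  pattern : HasPatternOfZeros N P

/-- An `n`-CF `ν`-sequence with `ν = n / m`; the sequence is indexed by `k = 0, 1, 2, …`, so the
numbers of variables are `n, 2n, 3n, …`. -/
structure IsNCFSequence (n m : ℕ) (N : ℕ → ℕ) (P : ∀ k, MvPolynomial (Fin (N k)) ℂ) : Prop
    extends IsNuSequence ((n : ℚ) / (m : ℚ)) N P where
  card_eq : ∀ k, N k = (k + 1) * n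
  clusterForm : ∀ k, HasClusterForm n m (P k)

/-- A `ν`-sequence of `n`-AMS polynomials: nothing is required of the filling fraction. The numbers
of variables tend to infinity, and the polynomials are not all constant. -/
structure IsNAMSSequence (n : ℕ) (N : ℕ → ℕ) (P : ∀ k, MvPolynomial (Fin (N k)) ℂ) : Prop where
  nams : ∀ k, IsNAMS n (P k)
  pattern : HasPatternOfZeros N P
  tendsto : Tendsto N atTop atTop
  nonconstant : ∃ k, 0 < maxDegree (P k)

end PatternOfZeros

namespace PatternOfZeros

open MvPolynomial Filter Topology

/-! ### Polynomial identities -/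

/-! Each fusion lowers the degree of a homogeneous polynomial by its order, and by UFC the total
order depends only on the final configuration (`HasTotalOrder.unique`). Fusing a cluster of `a`
particles at once has order `S_a` (`order_block_eq_S`): translation invariance places the cluster at
the origin. Building it from two smaller clusters gives `S_{a+b} = S_a + S_b + D_{a,b}` (`S_add`).

Let `d` be the highest degree of a variable. The condition `J_N = 0` makes `P` invariant under the
inversion `z ↦ -1/z` (`homogenizedEval_inversion`), so exponents may be replaced by their
complements to `d`. Hence the total degree of `a` variables is at most `ad - S_a`, and once these
variables are fused, the degree in the new variable is at most `ad - 2S_a = 2J_a`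
(`natDegree_slice_le`). With one `n`-cluster and single particles elsewhere, the derived polynomial
is divisible by the product of the `(z^(n) - z_i)^m`, where `m = D_{n,1}`. Its degree in `z^(n)` is
`m(N - n)`, which for an `n`-AMS polynomial equals `2J_n`, so nothing else depends on `z^(n)`. By
UFC every configuration with this cluster can be reached through that one, and the factorization
survives further fusion (`IsAMS.factorsAt`). The derived Laughlin state has the `n`-th power of the
same factor, which gives the cluster form.

Conversely, the cluster form forces `D_{n,b} = mb`. Iterating the recursion expresses `S_{jn+b}` by
`S_n` and `S_b`; with `J_N = 0` this gives the value of `J_n`, and with the inversion it gives the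
reflection formula.

Along a sequence, `m = S_{n+1} - S_n` is fixed by the pattern of zeros, and `n d_k = 2S_n + m(N_k -
n)` gives the filling fraction `n/m`. If `m` were zero, the degrees `d_k` would be bounded, which
forces every `S_a` to vanish and the polynomials to be constant. -/

theorem eq_of_eval_eq_of_eval_ne_zero {σ : Type*} {A B D : MvPolynomial σ ℂ} (hD : D ≠ 0)
    (h : ∀ z, eval z D ≠ 0 → eval z A = eval z B) : A = B := by
  have : D * A = D * B := by
    apply MvPolynomial.funext
    intro z
    by_cases hz : eval z D = 0
    · simp [hz]
    · simp [h z hz]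
  exact mul_left_cancel₀ hD this

theorem exists_eval_ne_zero {σ : Type*} {A : MvPolynomial σ ℂ} (hA : A ≠ 0) :
    ∃ z, eval z A ≠ 0 := by
  by_contra! h
  exact hA (MvPolynomial.funext fun z => by simp [h z])

theorem eval_aeval_polynomial {σ : Type*} (g : σ → Polynomial ℂ) (Q : MvPolynomial σ ℂ) (t : ℂ) :
    (aeval g Q).eval t = eval (fun i => (g i).eval t) Q := by
  have : (Polynomial.aeval t).comp (aeval g) = aeval (R := ℂ) (fun i => (g i).eval t) := by
    ext i; simp
  have h := DFunLike.congr_fun this Q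
  simpa [Polynomial.coe_aeval_eq_eval, coe_aeval_eq_eval] using h

theorem eval_fusionExpansion {N : ℕ} {r s : Setoid (Fin N)} (h : r ≤ s)
    (Q : MvPolynomial (Quotient r) ℂ) (z : Quotient s → ℂ) (ξ : Quotient r → ℂ) (t : ℂ) :
    (fusionExpansion h Q z ξ).eval t = eval (fun x => z (fuseMap h x) + t * ξ x) Q := by
  simp [fusionExpansion, eval_aeval_polynomial, mul_comm t]

theorem coeff_mul_of_coeff_eq_zero {p q : Polynomial ℂ} {a b : ℕ} (hp : ∀ j < a, p.coeff j = 0)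
    (hq : ∀ j < b, q.coeff j = 0) :
    (∀ j < a + b, (p * q).coeff j = 0) ∧ (p * q).coeff (a + b) = p.coeff a * q.coeff b := by
  obtain ⟨p, rfl⟩ := Polynomial.X_pow_dvd_iff.2 hp
  obtain ⟨q, rfl⟩ := Polynomial.X_pow_dvd_iff.2 hq
  have : Polynomial.X ^ a * p * (Polynomial.X ^ b * q) = Polynomial.X ^ (a + b) * (p * q) := by ring
  rw [this]
  refine ⟨fun j hj => ?_, ?_⟩
  · rw [Polynomial.coeff_X_pow_mul', if_neg (by omega)]
  · simp [Polynomial.coeff_X_pow_mul']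

theorem coeff_mul_of_coeff_lt_eq_zero {p q : Polynomial ℂ} {a : ℕ} (hp : ∀ j < a, p.coeff j = 0) :
    (p * q).coeff a = p.coeff a * q.coeff 0 := by
  simpa using (coeff_mul_of_coeff_eq_zero (b := 0) (q := q) hp (by simp)).2

/-! ### Derived steps of a given order -/

/-- A derived step in which the lowest nonvanishing power of `lam` is `d`. -/
def IsStepOfOrder {N : ℕ} {r s : Setoid (Fin N)} (h : r ≤ s)
    (Q : MvPolynomial (Quotient r) ℂ) (Q' : MvPolynomial (Quotient s) ℂ) (d : ℕ) : Prop :=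
  ∃ R : MvPolynomial (Quotient r) ℂ,
    (∀ (z : Quotient s → ℂ) (ξ : Quotient r → ℂ), IsCentered s ξ →
      (∀ j < d, (fusionExpansion h Q z ξ).coeff j = 0) ∧
      (fusionExpansion h Q z ξ).coeff d = eval ξ R * eval z Q') ∧
    ∃ (z : Quotient s → ℂ) (ξ : Quotient r → ℂ), IsCentered s ξ ∧ eval ξ R * eval z Q' ≠ 0

section Steps

variable {N : ℕ} {r s : Setoid (Fin N)} {h : r ≤ s}

theorem isDerivedStep_iff {Q : MvPolynomial (Quotient r) ℂ} {Q' : MvPolynomial (Quotient s) ℂ} :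
    IsDerivedStep h Q Q' ↔ ∃ d, IsStepOfOrder h Q Q' d := Iff.rfl

theorem IsStepOfOrder.ne_zero {Q : MvPolynomial (Quotient r) ℂ} {Q' : MvPolynomial (Quotient s) ℂ}
    {d : ℕ} (hQ : IsStepOfOrder h Q Q' d) : Q' ≠ 0 := by
  rintro rfl
  obtain ⟨R, -, z, ξ, -, hne⟩ := hQ
  simp at hne

theorem IsStepOfOrder.exists_centered {Q : MvPolynomial (Quotient r) ℂ}
    {Q' : MvPolynomial (Quotient s) ℂ} {d : ℕ} (hQ : IsStepOfOrder h Q Q' d) :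
    ∃ (ξ : Quotient r → ℂ) (c : ℂ), IsCentered s ξ ∧ c ≠ 0 ∧ ∀ z : Quotient s → ℂ,
      (∀ j < d, (fusionExpansion h Q z ξ).coeff j = 0) ∧
      (fusionExpansion h Q z ξ).coeff d = c * eval z Q' := by
  obtain ⟨R, hR, z, ξ, hξ, hne⟩ := hQ
  exact ⟨ξ, eval ξ R, hξ, left_ne_zero_of_mul hne, fun z => hR z ξ hξ⟩

theorem IsStepOfOrder.order_le {Q : MvPolynomial (Quotient r) ℂ}
    {Q₁ Q₂ : MvPolynomial (Quotient s) ℂ} {d₁ d₂ : ℕ} (h₁ : IsStepOfOrder h Q Q₁ d₁)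
    (h₂ : IsStepOfOrder h Q Q₂ d₂) : d₂ ≤ d₁ := by
  by_contra! hlt
  obtain ⟨R₁, hR₁, z, ξ, hξ, hne⟩ := h₁
  obtain ⟨R₂, hR₂, -⟩ := h₂
  exact hne ((hR₁ z ξ hξ).2 ▸ (hR₂ z ξ hξ).1 _ hlt)

theorem IsStepOfOrder.order_eq {Q : MvPolynomial (Quotient r) ℂ}
    {Q₁ Q₂ : MvPolynomial (Quotient s) ℂ} {d₁ d₂ : ℕ} (h₁ : IsStepOfOrder h Q Q₁ d₁)
    (h₂ : IsStepOfOrder h Q Q₂ d₂) : d₁ = d₂ :=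
  le_antisymm (h₂.order_le h₁) (h₁.order_le h₂)

/-- Both factorizations describe the same lowest coefficient. Freezing one centered `ξ` with `R₂(ξ)
≠ 0` makes the two derived polynomials proportional in `z`. -/
theorem IsDerivedStep.unique {Q : MvPolynomial (Quotient r) ℂ}
    {Q₁ Q₂ : MvPolynomial (Quotient s) ℂ} (h₁ : IsDerivedStep h Q Q₁)
    (h₂ : IsDerivedStep h Q Q₂) : ∃ c : ℂ, c ≠ 0 ∧ Q₂ = C c * Q₁ := by
  obtain ⟨d₁, h₁⟩ := isDerivedStep_iff.1 h₁
  obtain ⟨d₂, h₂⟩ := isDerivedStep_iff.1 h₂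
  obtain rfl := h₁.order_eq h₂
  have hQ₁ := h₁.ne_zero
  obtain ⟨R₁, hR₁, -⟩ := h₁
  obtain ⟨R₂, hR₂, z, ξ, hξ, hne⟩ := h₂
  have hz : ∀ w, eval ξ R₁ * eval w Q₁ = eval ξ R₂ * eval w Q₂ := fun w =>
    (hR₁ w ξ hξ).2.symm.trans (hR₂ w ξ hξ).2
  have h2 : eval ξ R₂ ≠ 0 := left_ne_zero_of_mul hne
  refine ⟨eval ξ R₁ / eval ξ R₂, div_ne_zero ?_ h2, MvPolynomial.funext fun w => ?_⟩
  · intro h0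
    have := hz z
    rw [h0, zero_mul] at this
    exact hne this.symm
  · simp only [eval_mul, eval_C]
    field_simp
    linear_combination -hz w

theorem IsStepOfOrder.C_mul {Q : MvPolynomial (Quotient r) ℂ} {Q' : MvPolynomial (Quotient s) ℂ}
    {d : ℕ} (hQ : IsStepOfOrder h Q Q' d) {c : ℂ} (hc : c ≠ 0) :
    IsStepOfOrder h (C c * Q) Q' d := by
  obtain ⟨R, hR, z, ξ, hξ, hne⟩ := hQ
  have hexp : ∀ z ξ, fusionExpansion h (C c * Q) z ξ =
      Polynomial.C c * fusionExpansion h Q z ξ := by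
    intro z ξ
    simp [fusionExpansion]
  refine ⟨C c * R, fun z ξ hξ => ⟨fun j hj => ?_, ?_⟩, z, ξ, hξ, ?_⟩
  · simp [hexp, (hR z ξ hξ).1 j hj]
  · simp [hexp, (hR z ξ hξ).2, mul_assoc]
  · simp only [eval_mul, eval_C, mul_assoc]
    exact mul_ne_zero hc hne

theorem IsCentered.line {ξ₁ ξ₂ : Quotient r → ℂ} (h₁ : IsCentered s ξ₁) (h₂ : IsCentered s ξ₂)
    (t : ℂ) : IsCentered s (fun x => ξ₁ x + t * (ξ₂ x - ξ₁ x)) := by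
  classical
  intro y
  have e₁ := h₁ y
  have e₂ := h₂ y
  have : ∀ i : Fin N, (if Quotient.mk s i = y then
      (ξ₁ (Quotient.mk r i) + t * (ξ₂ (Quotient.mk r i) - ξ₁ (Quotient.mk r i))) else 0) =
      (1 - t) * (if Quotient.mk s i = y then ξ₁ (Quotient.mk r i) else 0) +
      t * (if Quotient.mk s i = y then ξ₂ (Quotient.mk r i) else 0) := by
    intro i
    split_ifs <;> ring
  simp only [this, Finset.sum_add_distrib, ← Finset.mul_sum]
  rw [e₁, e₂]
  simp

/-- Centered displacements form a linear space. On the line through `ξ₁` and `ξ₂` both polynomials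
restrict to nonzero polynomials in one variable, whose product has a nonzero value. -/
theorem exists_centered_eval_mul_ne_zero {R₁ R₂ : MvPolynomial (Quotient r) ℂ}
    {ξ₁ ξ₂ : Quotient r → ℂ} (h₁ : IsCentered s ξ₁) (h₂ : IsCentered s ξ₂)
    (hR₁ : eval ξ₁ R₁ ≠ 0) (hR₂ : eval ξ₂ R₂ ≠ 0) :
    ∃ ξ : Quotient r → ℂ, IsCentered s ξ ∧ eval ξ R₁ * eval ξ R₂ ≠ 0 := by
  let g : Quotient r → Polynomial ℂ := fun x =>
    Polynomial.C (ξ₁ x) + Polynomial.X * Polynomial.C (ξ₂ x - ξ₁ x)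
  have hev : ∀ (R : MvPolynomial (Quotient r) ℂ) (t : ℂ), (aeval g R).eval t =
      eval (fun x => ξ₁ x + t * (ξ₂ x - ξ₁ x)) R := by
    intro R t
    rw [eval_aeval_polynomial]
    simp [g]
  have n₁ : aeval g R₁ ≠ 0 := by
    intro h0
    have := hev R₁ 0
    rw [h0] at this
    simp at this
    exact hR₁ this.symm
  have n₂ : aeval g R₂ ≠ 0 := by
    intro h0
    have := hev R₂ 1
    rw [h0] at this
    simp at this
    exact hR₂ this.symm
  have : ∃ t : ℂ, (aeval g R₁ * aeval g R₂).eval t ≠ 0 := by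
    by_contra! h0
    exact mul_ne_zero n₁ n₂ (Polynomial.funext fun t => by rw [h0 t]; simp)
  obtain ⟨t, ht⟩ := this
  rw [Polynomial.eval_mul, hev, hev] at ht
  exact ⟨_, h₁.line h₂ t, ht⟩

theorem IsStepOfOrder.mul {Q₁ Q₂ : MvPolynomial (Quotient r) ℂ}
    {Q₁' Q₂' : MvPolynomial (Quotient s) ℂ} {d₁ d₂ : ℕ} (h₁ : IsStepOfOrder h Q₁ Q₁' d₁)
    (h₂ : IsStepOfOrder h Q₂ Q₂' d₂) : IsStepOfOrder h (Q₁ * Q₂) (Q₁' * Q₂') (d₁ + d₂) := by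
  have hne : Q₁' * Q₂' ≠ 0 := mul_ne_zero h₁.ne_zero h₂.ne_zero
  obtain ⟨R₁, hR₁, z₁, ξ₁, hξ₁, hne₁⟩ := h₁
  obtain ⟨R₂, hR₂, z₂, ξ₂, hξ₂, hne₂⟩ := h₂
  have hexp : ∀ z ξ, fusionExpansion h (Q₁ * Q₂) z ξ =
      fusionExpansion h Q₁ z ξ * fusionExpansion h Q₂ z ξ := by
    intro z ξ
    simp [fusionExpansion]
  obtain ⟨z, hz⟩ := exists_eval_ne_zero hne
  obtain ⟨ξ, hξ, hRξ⟩ := exists_centered_eval_mul_ne_zero hξ₁ hξ₂ (left_ne_zero_of_mul hne₁)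
    (left_ne_zero_of_mul hne₂)
  refine ⟨R₁ * R₂, fun z ξ hξ => ?_, z, ξ, hξ, ?_⟩
  · have := coeff_mul_of_coeff_eq_zero (hR₁ z ξ hξ).1 (hR₂ z ξ hξ).1
    rw [hexp]
    refine ⟨this.1, ?_⟩
    rw [this.2, (hR₁ z ξ hξ).2, (hR₂ z ξ hξ).2]
    simp only [eval_mul]
    ring
  · rw [map_mul (eval ξ)]
    exact mul_ne_zero hRξ hz

theorem isStepOfOrder_rename {Q : MvPolynomial (Quotient r) ℂ}
    (hQ : rename (fuseMap h) Q ≠ 0) : IsStepOfOrder h Q (rename (fuseMap h) Q) 0 := by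
  obtain ⟨z, hz⟩ := exists_eval_ne_zero hQ
  refine ⟨1, fun z ξ _ => ⟨by simp, ?_⟩, z, 0, ?_, by simpa using hz⟩
  · rw [Polynomial.coeff_zero_eq_eval_zero, eval_fusionExpansion, eval_rename]
    simp [Function.comp_def]
  · intro y
    simp

theorem isStepOfOrder_one : IsStepOfOrder h 1 1 0 := by
  simpa using isStepOfOrder_rename (h := h) (Q := 1) (by simp)

theorem IsStepOfOrder.pow {Q : MvPolynomial (Quotient r) ℂ} {Q' : MvPolynomial (Quotient s) ℂ}
    {d : ℕ} (hQ : IsStepOfOrder h Q Q' d) (k : ℕ) : IsStepOfOrder h (Q ^ k) (Q' ^ k) (k * d) := by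
  induction k with
  | zero => simpa using isStepOfOrder_one
  | succ k ih => simpa [pow_succ, Nat.succ_mul] using ih.mul hQ

theorem IsDerivedStep.mul {Q₁ Q₂ : MvPolynomial (Quotient r) ℂ}
    {Q₁' Q₂' : MvPolynomial (Quotient s) ℂ} (h₁ : IsDerivedStep h Q₁ Q₁')
    (h₂ : IsDerivedStep h Q₂ Q₂') : IsDerivedStep h (Q₁ * Q₂) (Q₁' * Q₂') := by
  obtain ⟨d₁, h₁⟩ := isDerivedStep_iff.1 h₁
  obtain ⟨d₂, h₂⟩ := isDerivedStep_iff.1 h₂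
  exact ⟨_, h₁.mul h₂⟩

theorem IsDerivedStep.prod {ι : Type*} (t : Finset ι) {Q : ι → MvPolynomial (Quotient r) ℂ}
    {Q' : ι → MvPolynomial (Quotient s) ℂ} (hQ : ∀ i ∈ t, IsDerivedStep h (Q i) (Q' i)) :
    IsDerivedStep h (∏ i ∈ t, Q i) (∏ i ∈ t, Q' i) := by
  classical
  induction t using Finset.induction_on with
  | empty => exact ⟨0, by simpa [IsStepOfOrder] using isStepOfOrder_one (h := h)⟩
  | insert a t ha ih =>
    rw [Finset.prod_insert ha, Finset.prod_insert ha]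
    exact (hQ a (Finset.mem_insert_self a t)).mul
      (ih fun i hi => hQ i (Finset.mem_insert_of_mem hi))

end Steps

/-! ### Particle types and centered displacements -/

section ParticleType

variable {N : ℕ} {r : Setoid (Fin N)}

open Classical in
theorem particleType_eq_card (x : Quotient r) :
    particleType x = (Finset.univ.filter fun i : Fin N => Quotient.mk r i = x).card := by
  rw [particleType, ← Set.ncard_coe_finset]
  simp

theorem particleType_pos (x : Quotient r) : 0 < particleType x := by
  classical
  rw [particleType_eq_card, Finset.card_pos]
  obtain ⟨i, rfl⟩ := Quotient.exists_rep x
  exact ⟨i, by simp⟩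

open Classical in
theorem sum_ite_mk_eq (x : Quotient r) (c : ℂ) :
    ∑ i : Fin N, (if Quotient.mk r i = x then c else 0) = particleType x * c := by
  rw [particleType_eq_card, ← Finset.sum_filter]
  simp

theorem exists_centered_ne {s : Setoid (Fin N)} (h : r ≤ s) {x y : Quotient r} (hxy : x ≠ y)
    (hf : fuseMap h x = fuseMap h y) : ∃ ξ : Quotient r → ℂ, IsCentered s ξ ∧ ξ x ≠ ξ y := by
  classical
  -- Displacements inversely proportional to the types, in opposite directions, keep the centre of
  -- mass fixed.
  refine ⟨fun w => (if w = x then (particleType y : ℂ) else 0) -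
    (if w = y then (particleType x : ℂ) else 0), ?_, ?_⟩
  · intro w
    have hsum : ∀ (u : Quotient r) (c : ℂ), ∑ i : Fin N, (if Quotient.mk s i = w then
        (if Quotient.mk r i = u then c else 0) else 0) =
        if fuseMap h u = w then particleType u * c else 0 := by
      intro u c
      split_ifs with hu
      · rw [← sum_ite_mk_eq]
        refine Finset.sum_congr rfl fun i _ => ?_
        by_cases hi : Quotient.mk r i = u
        · rw [if_pos (by rw [← hu, ← hi]; rfl)]
        · simp [hi]
      · refine Finset.sum_eq_zero fun i _ => ?_
        by_cases hi : Quotient.mk r i = u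
        · rw [if_neg (fun h1 => hu (by rw [← h1, ← hi]; rfl))]
        · simp [hi]
    have hsplit : ∀ i : Fin N, (if Quotient.mk s i = w then
        ((if Quotient.mk r i = x then (particleType y : ℂ) else 0) -
        (if Quotient.mk r i = y then (particleType x : ℂ) else 0)) else 0) =
        (if Quotient.mk s i = w then
          (if Quotient.mk r i = x then (particleType y : ℂ) else 0) else 0) -
        (if Quotient.mk s i = w then
          (if Quotient.mk r i = y then (particleType x : ℂ) else 0) else 0) := by
      intro i
      by_cases h1 : Quotient.mk s i = w <;> simp only [h1, if_true, if_false, sub_zero]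
    simp only [hsplit, Finset.sum_sub_distrib, hsum, hf]
    split_ifs <;> ring
  · simp only [if_true, if_neg hxy, if_neg hxy.symm, sub_zero, zero_sub]
    intro h0
    have : ((particleType y + particleType x : ℕ) : ℂ) = 0 := by
      push_cast
      linear_combination h0
    have := particleType_pos x
    norm_cast at *
    omega

theorem isStepOfOrder_X_sub_X {s : Setoid (Fin N)} (h : r ≤ s) {x y : Quotient r} (hxy : x ≠ y)
    (hf : fuseMap h x = fuseMap h y) : IsStepOfOrder h (X x - X y) 1 1 := by
  obtain ⟨ξ, hξ, hne⟩ := exists_centered_ne h hxy hf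
  refine ⟨X x - X y, fun z ξ _ => ?_, 0, ξ, hξ, by simpa using sub_ne_zero.2 hne⟩
  have : fusionExpansion h (X x - X y) z ξ = Polynomial.X * Polynomial.C (ξ x - ξ y) := by
    simp only [fusionExpansion, map_sub, aeval_X, hf]
    ring
  rw [this]
  refine ⟨fun j hj => ?_, ?_⟩
  · obtain rfl : j = 0 := by omega
    simp
  · simp

theorem IsCentered.eq_zero_of_fiber {s : Setoid (Fin N)} (h : r ≤ s) {ξ : Quotient r → ℂ}
    (hξ : IsCentered s ξ) {x : Quotient r} (hx : ∀ y, fuseMap h y = fuseMap h x → y = x) :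
    ξ x = 0 := by
  classical
  have := hξ (fuseMap h x)
  have e : ∀ i : Fin N, (if Quotient.mk s i = fuseMap h x then ξ (Quotient.mk r i) else 0) =
      if Quotient.mk r i = x then ξ x else 0 := by
    intro i
    have : Quotient.mk s i = fuseMap h x ↔ Quotient.mk r i = x :=
      ⟨fun h1 => hx _ h1, fun h1 => by rw [← h1]; rfl⟩
    by_cases h1 : Quotient.mk r i = x
    · simp [this, h1]
    · simp [this, h1]
  simp only [e, sum_ite_mk_eq] at this
  rcases mul_eq_zero.1 this with h0 | h0
  · have := particleType_pos x
    norm_cast at h0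
    omega
  · exact h0

end ParticleType

/-! ### Divisibility by a difference of two variables -/

section Divisibility

variable {σ : Type*} [DecidableEq σ]

/-- Modulo the ideal generated by `X x - X y`, replacing `x` by `y` changes no variable, hence no
polynomial. -/
theorem X_sub_X_dvd_sub_rename (x y : σ) (p : MvPolynomial σ ℂ) :
    X x - X y ∣ p - rename (Function.update id x y) p := by
  rw [← Ideal.mem_span_singleton, ← Ideal.Quotient.eq]
  have : (Ideal.Quotient.mkₐ ℂ (Ideal.span {(X x - X y : MvPolynomial σ ℂ)})) =
      (Ideal.Quotient.mkₐ ℂ (Ideal.span {(X x - X y : MvPolynomial σ ℂ)})).comp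
        (rename (Function.update id x y)) := by
    apply MvPolynomial.algHom_ext
    intro i
    by_cases hi : i = x
    · subst hi
      simp only [AlgHom.comp_apply, rename_X, Function.update_self, Ideal.Quotient.mkₐ_eq_mk]
      rw [Ideal.Quotient.eq]
      exact Ideal.mem_span_singleton_self _
    · simp [Function.update_of_ne hi]
  exact DFunLike.congr_fun this p

theorem X_sub_X_dvd_iff {x y : σ} {p : MvPolynomial σ ℂ} :
    X x - X y ∣ p ↔ rename (Function.update id x y) p = 0 := by
  constructor
  · rintro ⟨q, rfl⟩
    by_cases hxy : y = x
    · simp [hxy]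
    · simp [Function.update_of_ne hxy]
  · intro h0
    simpa [h0] using X_sub_X_dvd_sub_rename x y p

theorem X_sub_X_ne_zero {σ : Type*} {x y : σ} (hxy : x ≠ y) : (X x - X y : MvPolynomial σ ℂ) ≠ 0 := by
  intro h
  exact hxy (X_injective (R := ℂ) (sub_eq_zero.1 h))

/-- Divisibility by `X x - X y` means lying in the kernel of a homomorphism into a domain. -/
theorem prime_X_sub_X {x y : σ} (hxy : x ≠ y) : Prime (X x - X y : MvPolynomial σ ℂ) := by
  refine ⟨X_sub_X_ne_zero hxy, fun hu => ?_, fun a b hab => ?_⟩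
  · have := X_sub_X_dvd_iff.1 (hu.dvd (a := 1))
    simp at this
  · simpa [X_sub_X_dvd_iff] using hab

/-- Write `Q = (X x - X y) ^ D * G`. The power contributes exactly `lam ^ D`, and `G`, not being
divisible by `X x - X y`, survives the identification of `x` with `y` at order zero. -/
theorem exists_step_of_merge {N : ℕ} {r s : Setoid (Fin N)} (h : r ≤ s) {x y : Quotient r}
    (hxy : x ≠ y) (hf : fuseMap h x = fuseMap h y)
    (hmerge : ∀ u v, fuseMap h u = fuseMap h v → u = v ∨ (u = x ∧ v = y) ∨ (u = y ∧ v = x))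
    {Q : MvPolynomial (Quotient r) ℂ} {D : ℕ} (hD : emultiplicity (X x - X y) Q = (D : ℕ∞)) :
    ∃ Q', IsStepOfOrder h Q Q' D := by
  classical
  obtain ⟨⟨G, rfl⟩, hndvd⟩ := emultiplicity_eq_coe.1 hD
  have hG : ¬ (X x - X y ∣ G) := by
    rintro ⟨G', rfl⟩
    exact hndvd ⟨G', by ring⟩
  have hne : rename (fuseMap h) G ≠ 0 := by
    intro h0
    apply hG
    rw [X_sub_X_dvd_iff]
    have hfac : (Function.update id x y : Quotient r → Quotient r).FactorsThrough (fuseMap h) := by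
      intro u v huv
      rcases hmerge u v huv with rfl | ⟨rfl, rfl⟩ | ⟨rfl, rfl⟩
      · rfl
      · simp [Function.update_of_ne hxy.symm]
      · simp [Function.update_of_ne hxy.symm]
    -- The substitution `x ↦ y` factors through the fusion map, so if the fusion killed `G`, the
    -- substitution would too.
    have : (Function.update id x y : Quotient r → Quotient r) =
        Function.extend (fuseMap h) (Function.update id x y) (fun _ => x) ∘ fuseMap h := by
      funext u
      exact (hfac.extend_apply _ u).symm
    rw [this, ← rename_rename, h0, map_zero]
  have := ((isStepOfOrder_X_sub_X h hxy hf).pow D).mul (isStepOfOrder_rename hne)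
  exact ⟨_, by simpa using this⟩

end Divisibility

/-! ### Total order of a fusion process -/

/-- `Q` scales with degree `e - T`. For a derived polynomial of a homogeneous polynomial of
degree `e`, the number `T` is the sum of the orders of the fusions. -/
def ScalesBy {σ : Type*} (e T : ℕ) (Q : MvPolynomial σ ℂ) : Prop :=
  ∀ (t : ℂ) (z : σ → ℂ), t ^ T * eval (fun i => t * z i) Q = t ^ e * eval z Q

theorem ScalesBy.unique {σ : Type*} {e T T' : ℕ} {Q : MvPolynomial σ ℂ} (hQ : Q ≠ 0)
    (h : ScalesBy e T Q) (h' : ScalesBy e T' Q) : T = T' := by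
  obtain ⟨z, hz⟩ := exists_eval_ne_zero hQ
  -- The scale factor `2` suffices because its powers are distinct.
  have h1 := h 2 z
  have h2 := h' 2 z
  have h3 : eval (fun i => 2 * z i) Q ≠ 0 := by
    intro h0
    rw [h0, mul_zero] at h1
    exact mul_ne_zero (pow_ne_zero e two_ne_zero) hz h1.symm
  have h4 : (2 : ℂ) ^ T = 2 ^ T' := mul_right_cancel₀ h3 (h1.trans h2.symm)
  have h5 : (2 : ℕ) ^ T = 2 ^ T' := by exact_mod_cast h4
  exact Nat.pow_right_injective le_rfl h5

theorem ScalesBy.C_mul {σ : Type*} {e T : ℕ} {Q : MvPolynomial σ ℂ} (h : ScalesBy e T Q) (c : ℂ) :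
    ScalesBy e T (C c * Q) := by
  intro t z
  simp only [map_mul, eval_C]
  linear_combination c * h t z

/-- Scaling `z` and `lam` together by `t` scales all old positions by `t`. The coefficient of `lam ^
d` then picks up an extra `t ^ d`. -/
theorem ScalesBy.step {N : ℕ} {r s : Setoid (Fin N)} {h : r ≤ s} {e T d : ℕ}
    {Q : MvPolynomial (Quotient r) ℂ} {Q' : MvPolynomial (Quotient s) ℂ} (hQ : ScalesBy e T Q)
    (hstep : IsStepOfOrder h Q Q' d) : ScalesBy e (T + d) Q' := by
  intro t z
  obtain ⟨ξ, c, -, hc, hcoeff⟩ := hstep.exists_centered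
  have key : Polynomial.C (t ^ T) *
      (fusionExpansion h Q (fun y => t * z y) ξ).comp (Polynomial.C t * Polynomial.X) =
      Polynomial.C (t ^ e) * fusionExpansion h Q z ξ := by
    apply Polynomial.funext
    intro a
    simp only [Polynomial.eval_mul, Polynomial.eval_C, Polynomial.eval_comp, Polynomial.eval_X,
      eval_fusionExpansion]
    rw [← hQ]
    congr 3
    funext x
    ring
  have h1 := congrArg (fun p => Polynomial.coeff p d) key
  simp only [Polynomial.coeff_C_mul, Polynomial.comp_C_mul_X_coeff] at h1
  rw [(hcoeff _).2, (hcoeff _).2] at h1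
  apply mul_left_cancel₀ hc
  rw [pow_add]
  linear_combination h1

theorem ScalesBy.of_isHomogeneous {σ : Type*} {e : ℕ} {P : MvPolynomial σ ℂ}
    (hP : P.IsHomogeneous e) : ScalesBy e 0 P := by
  intro t z
  rw [pow_zero, one_mul, MvPolynomial.eval_eq, MvPolynomial.eval_eq, Finset.mul_sum]
  refine Finset.sum_congr rfl fun m hm => ?_
  have hdeg : ∑ i ∈ m.support, m i = e := by
    rw [← hP (mem_support_iff.1 hm), Finsupp.weight_apply]
    simp [Finsupp.sum]
  simp only [mul_pow, Finset.prod_mul_distrib, Finset.prod_pow_eq_pow_sum, hdeg]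
  ring

section Processes

variable {N : ℕ} {P : MvPolynomial (Fin N) ℂ}

/-- Even the trivial fusion of `⊥` to itself has to produce a nonzero coefficient. -/
theorem IsUFC.ne_zero (hP : IsUFC P) : P ≠ 0 := by
  rintro rfl
  obtain ⟨Q, Q₀, hQ₀, hstep⟩ := hP.1 ⊥ (.fuse .start ⊥ le_rfl)
  obtain ⟨d, hd⟩ := isDerivedStep_iff.1 hstep
  obtain ⟨R, hR, z, ξ, hξ, hne⟩ := hd
  have h0 : Q₀ = 0 := by simpa [FusionProcess.IsDerived] using hQ₀
  rw [← (hR z ξ hξ).2, h0] at hne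
  simp [fusionExpansion] at hne

theorem FusionProcess.IsDerived.ne_zero (hP : P ≠ 0) {r : Setoid (Fin N)}
    {p : FusionProcess N r} {Q : MvPolynomial (Quotient r) ℂ} (hQ : p.IsDerived P Q) : Q ≠ 0 := by
  cases p with
  | start =>
    rw [show Q = rename (Quotient.mk ⊥) P from hQ]
    have hinj : Function.Injective (Quotient.mk (⊥ : Setoid (Fin N))) := fun a b hab =>
      Quotient.exact hab
    exact (map_ne_zero_iff _ (rename_injective _ hinj)).2 hP
  | fuse p s h =>
    obtain ⟨Q₀, -, hstep⟩ := hQ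
    obtain ⟨d, hd⟩ := isDerivedStep_iff.1 hstep
    exact hd.ne_zero

/-- Some fusion process on `P`, which is homogeneous of degree `e`, leads to the configuration `r`
and has total order `T`. -/
def HasTotalOrder (P : MvPolynomial (Fin N) ℂ) (e : ℕ) (r : Setoid (Fin N)) (T : ℕ) : Prop :=
  ∃ (p : FusionProcess N r) (Q : MvPolynomial (Quotient r) ℂ), p.IsDerived P Q ∧ ScalesBy e T Q

/-- Derived polynomials of two processes with the same end differ by a scalar, so they have the same
degree. Computing `T` along different processes is the source of all relations between the `S_a` and
the `D_{a,b}`. -/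
theorem HasTotalOrder.unique (hP : IsUFC P) {e : ℕ} {r : Setoid (Fin N)} {T T' : ℕ}
    (h : HasTotalOrder P e r T) (h' : HasTotalOrder P e r T') : T = T' := by
  obtain ⟨p, Q, hQ, hT⟩ := h
  obtain ⟨p', Q', hQ', hT'⟩ := h'
  obtain ⟨c, -, rfl⟩ := hP.2 r p p' Q Q' hQ hQ'
  exact (hT.C_mul c).unique (hQ'.ne_zero hP.ne_zero) hT'

theorem hasTotalOrder_bot {e : ℕ} (hP : P.IsHomogeneous e) : HasTotalOrder P e ⊥ 0 :=
  ⟨.start, _, rfl, ScalesBy.of_isHomogeneous hP.rename_isHomogeneous⟩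

theorem HasTotalOrder.merge {e : ℕ} {r s : Setoid (Fin N)} {T a b D : ℕ}
    (hT : HasTotalOrder P e r T) (hD : HasLocalOrder P a b D) (h : r ≤ s) {x y : Quotient r}
    (hxy : x ≠ y) (hx : particleType x = a) (hy : particleType y = b)
    (hf : fuseMap h x = fuseMap h y)
    (hmerge : ∀ u v, fuseMap h u = fuseMap h v → u = v ∨ (u = x ∧ v = y) ∨ (u = y ∧ v = x)) :
    HasTotalOrder P e s (T + D) := by
  classical
  obtain ⟨p, Q, hQ, hsc⟩ := hT
  obtain ⟨Q', hQ'⟩ := exists_step_of_merge h hxy hf hmerge (hD r p Q hQ x y hxy hx hy)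
  exact ⟨.fuse p s h, Q', ⟨Q, hQ, isDerivedStep_iff.2 ⟨D, hQ'⟩⟩, hsc.step hQ'⟩

end Processes

/-! ### Configurations with at most two clusters -/

section TwoBlock

variable {N : ℕ}

/-- The cluster of `twoBlock A B` to which a particle belongs. -/
def blockLabel (A B : Finset (Fin N)) (i : Fin N) : Fin N ⊕ Bool :=
  if i ∈ A then .inr true else if i ∈ B then .inr false else .inl i

/-- The configuration in which the particles in `A` are fused and so are those in `B`. -/
def twoBlock (A B : Finset (Fin N)) : Setoid (Fin N) := Setoid.ker (blockLabel A B)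

theorem mk_twoBlock_eq_iff {A B : Finset (Fin N)} {i j : Fin N} :
    (Quotient.mk (twoBlock A B) i = Quotient.mk (twoBlock A B) j) ↔
      blockLabel A B i = blockLabel A B j := by
  rw [Quotient.eq]
  exact Iff.rfl

theorem mk_twoBlock_eq_iff' {A B : Finset (Fin N)} (hAB : Disjoint A B) {i j : Fin N} :
    (Quotient.mk (twoBlock A B) i = Quotient.mk (twoBlock A B) j) ↔
      i = j ∨ (i ∈ A ∧ j ∈ A) ∨ (i ∈ B ∧ j ∈ B) := by
  have h : ∀ i, i ∈ A → i ∉ B := fun _ hi => Finset.disjoint_left.1 hAB hi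
  rw [mk_twoBlock_eq_iff]
  unfold blockLabel
  have hi := h i
  have hj := h j
  split_ifs with h1 h2 h3 h4 h5 h6 h7 h8 <;> simp_all <;> (rintro rfl; simp_all)

theorem twoBlock_le_iff {A B : Finset (Fin N)} (hAB : Disjoint A B) {s : Setoid (Fin N)} :
    twoBlock A B ≤ s ↔ (∀ i ∈ A, ∀ j ∈ A, s i j) ∧ ∀ i ∈ B, ∀ j ∈ B, s i j := by
  have key : ∀ i j, (twoBlock A B) i j ↔ i = j ∨ (i ∈ A ∧ j ∈ A) ∨ (i ∈ B ∧ j ∈ B) := fun i j =>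
    Quotient.eq.symm.trans (mk_twoBlock_eq_iff' hAB)
  constructor
  · intro h
    exact ⟨fun i hi j hj => h ((key i j).2 (Or.inr (Or.inl ⟨hi, hj⟩))),
      fun i hi j hj => h ((key i j).2 (Or.inr (Or.inr ⟨hi, hj⟩)))⟩
  · rintro ⟨h1, h2⟩ i j hij
    rcases (key i j).1 hij with rfl | h | h
    · exact s.refl i
    · exact h1 i h.1 j h.2
    · exact h2 i h.1 j h.2

theorem twoBlock_rel_iff {A B : Finset (Fin N)} (hAB : Disjoint A B) {i j : Fin N} :
    (twoBlock A B) i j ↔ i = j ∨ (i ∈ A ∧ j ∈ A) ∨ (i ∈ B ∧ j ∈ B) :=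
  Quotient.eq.symm.trans (mk_twoBlock_eq_iff' hAB)

theorem twoBlock_singleton_right (A : Finset (Fin N)) {j : Fin N} (hj : j ∉ A) :
    twoBlock A {j} = twoBlock A ∅ := by
  ext a b
  rw [twoBlock_rel_iff (by simpa), twoBlock_rel_iff (by simp)]
  simp only [Finset.mem_singleton, Finset.notMem_empty, false_and, or_false]
  constructor
  · rintro (h | h | ⟨rfl, rfl⟩)
    · exact Or.inl h
    · exact Or.inr h
    · exact Or.inl rfl
  · rintro (h | h)
    · exact Or.inl h
    · exact Or.inr (Or.inl h)

theorem twoBlock_singleton_empty (j : Fin N) : twoBlock {j} ∅ = ⊥ := by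
  ext a b
  rw [twoBlock_rel_iff (by simp)]
  simp only [Finset.mem_singleton, Finset.notMem_empty, false_and, or_false, Setoid.bot_def]
  constructor
  · rintro (h | ⟨rfl, rfl⟩)
    · exact h
    · rfl
  · exact Or.inl

theorem particleType_twoBlock_left {A B : Finset (Fin N)} (hAB : Disjoint A B) {i : Fin N}
    (hi : i ∈ A) : particleType (Quotient.mk (twoBlock A B) i) = A.card := by
  rw [particleType, ← Set.ncard_coe_finset]
  congr 1
  ext j
  have := Finset.disjoint_left.1 hAB hi
  simp only [Set.mem_ofPred_eq, mk_twoBlock_eq_iff' hAB, Finset.mem_coe]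
  constructor
  · rintro (rfl | h | h)
    · exact hi
    · exact h.1
    · exact absurd h.2 this
  · exact fun h => Or.inr (Or.inl ⟨h, hi⟩)

theorem particleType_twoBlock_right {A B : Finset (Fin N)} (hAB : Disjoint A B) {i : Fin N}
    (hi : i ∈ B) : particleType (Quotient.mk (twoBlock A B) i) = B.card := by
  rw [particleType, ← Set.ncard_coe_finset]
  congr 1
  ext j
  have := Finset.disjoint_right.1 hAB hi
  simp only [Set.mem_ofPred_eq, mk_twoBlock_eq_iff' hAB, Finset.mem_coe]
  constructor
  · rintro (rfl | h | h)
    · exact hi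
    · exact absurd h.2 this
    · exact h.1
  · exact fun h => Or.inr (Or.inr ⟨h, hi⟩)

theorem particleType_twoBlock_other {A B : Finset (Fin N)} (hAB : Disjoint A B) {i : Fin N}
    (hA : i ∉ A) (hB : i ∉ B) : particleType (Quotient.mk (twoBlock A B) i) = 1 := by
  rw [particleType, Set.ncard_eq_one]
  refine ⟨i, ?_⟩
  ext j
  simp [mk_twoBlock_eq_iff' hAB, hA, hB]

theorem HasTotalOrder.insert_right {P : MvPolynomial (Fin N) ℂ} {e T D : ℕ} {A B : Finset (Fin N)}
    (hAB : Disjoint A B) (hB : B.Nonempty) {j : Fin N} (hjA : j ∉ A) (hjB : j ∉ B)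
    (hT : HasTotalOrder P e (twoBlock A B) T) (hD : HasLocalOrder P B.card 1 D) :
    HasTotalOrder P e (twoBlock A (insert j B)) (T + D) := by
  obtain ⟨b, hb⟩ := hB
  have hAB' : Disjoint A (insert j B) := by simp [hjA, hAB]
  have hle : twoBlock A B ≤ twoBlock A (insert j B) := by
    rw [twoBlock_le_iff hAB]
    simp only [twoBlock_rel_iff hAB']
    grind
  refine hT.merge hD hle (x := Quotient.mk _ b) (y := Quotient.mk _ j) ?_
    (particleType_twoBlock_right hAB hb) (particleType_twoBlock_other hAB hjA hjB) ?_ ?_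
  · rw [Ne, mk_twoBlock_eq_iff' hAB]
    grind
  · change Quotient.mk (twoBlock A (insert j B)) b = Quotient.mk _ j
    rw [mk_twoBlock_eq_iff' hAB']
    grind
  · intro u v
    induction u using Quotient.inductionOn with | _ u
    induction v using Quotient.inductionOn with | _ v
    intro huv
    change Quotient.mk (twoBlock A (insert j B)) u = Quotient.mk _ v at huv
    rw [mk_twoBlock_eq_iff' hAB'] at huv
    simp only [mk_twoBlock_eq_iff' hAB]
    grind

theorem HasTotalOrder.union {P : MvPolynomial (Fin N) ℂ} {e T D : ℕ} {A B : Finset (Fin N)}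
    (hAB : Disjoint A B) (hA : A.Nonempty) (hB : B.Nonempty)
    (hT : HasTotalOrder P e (twoBlock A B) T) (hD : HasLocalOrder P A.card B.card D) :
    HasTotalOrder P e (twoBlock (A ∪ B) ∅) (T + D) := by
  obtain ⟨a, ha⟩ := hA
  obtain ⟨b, hb⟩ := hB
  have hAB' : Disjoint (A ∪ B) ∅ := by simp
  have hdis : ∀ i, i ∈ A → i ∉ B := fun _ hi => Finset.disjoint_left.1 hAB hi
  have hle : twoBlock A B ≤ twoBlock (A ∪ B) ∅ := by
    rw [twoBlock_le_iff hAB]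
    simp only [twoBlock_rel_iff hAB']
    grind
  refine hT.merge hD hle (x := Quotient.mk _ a) (y := Quotient.mk _ b) ?_
    (particleType_twoBlock_left hAB ha) (particleType_twoBlock_right hAB hb) ?_ ?_
  · rw [Ne, mk_twoBlock_eq_iff' hAB]
    grind
  · change Quotient.mk (twoBlock (A ∪ B) ∅) a = Quotient.mk _ b
    rw [mk_twoBlock_eq_iff' hAB']
    grind
  · intro u v
    induction u using Quotient.inductionOn with | _ u
    induction v using Quotient.inductionOn with | _ v
    intro huv
    change Quotient.mk (twoBlock (A ∪ B) ∅) u = Quotient.mk _ v at huv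
    rw [mk_twoBlock_eq_iff' hAB'] at huv
    simp only [mk_twoBlock_eq_iff' hAB]
    grind

end TwoBlock

/-! ### The numbers `S_a` -/

section MinDegree

variable {N : ℕ} {P : MvPolynomial (Fin N) ℂ}

/-- `S` refers to the first variables; for symmetric `P` such a permutation carries it over to any
set of the same size. -/
theorem exists_perm_mem_iff_lt (A : Finset (Fin N)) :
    ∃ e : Equiv.Perm (Fin N), ∀ i, ((e i : Fin N) : ℕ) < A.card ↔ i ∈ A := by
  classical
  have hcard : A.card ≤ N := by simpa using A.card_le_univ
  have e₀ : {i // i ∈ A} ≃ {i : Fin N // (i : ℕ) < A.card} := by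
    apply Fintype.equivOfCardEq
    rw [Fintype.card_coe, Fintype.card_subtype, Fin.card_filter_val_lt, min_eq_right hcard]
  refine ⟨e₀.extendSubtype, fun i => ⟨fun h => ?_, fun h => e₀.extendSubtype_mem i h⟩⟩
  by_contra hi
  exact e₀.extendSubtype_not_mem i hi h

theorem mapDomain_mem_support (hP : P.IsSymmetric) (e : Equiv.Perm (Fin N)) {m : Fin N →₀ ℕ}
    (hm : m ∈ P.support) : m.mapDomain e ∈ P.support := by
  rw [mem_support_iff] at hm ⊢
  rwa [← hP e, coeff_rename_mapDomain _ e.injective]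

theorem S_le (hP : P.IsSymmetric) (A : Finset (Fin N)) {m : Fin N →₀ ℕ} (hm : m ∈ P.support) :
    S P A.card ≤ ∑ i ∈ A, m i := by
  obtain ⟨e, he⟩ := exists_perm_mem_iff_lt A
  refine Nat.sInf_le ⟨m.mapDomain e, mapDomain_mem_support hP e hm, ?_⟩
  rw [← Equiv.sum_comp e]
  simp only [he, Finsupp.mapDomain_apply e.injective]
  rw [Finset.sum_ite_mem, Finset.univ_inter]

theorem exists_sum_eq_S (hP : P.IsSymmetric) (hne : P ≠ 0) (A : Finset (Fin N)) :
    ∃ m ∈ P.support, ∑ i ∈ A, m i = S P A.card := by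
  obtain ⟨e, he⟩ := exists_perm_mem_iff_lt A
  have hmem : S P A.card ∈ {t : ℕ | ∃ m ∈ P.support,
      t = ∑ i : Fin N, if (i : ℕ) < A.card then m i else 0} := by
    apply Nat.sInf_mem
    obtain ⟨m, hm⟩ := support_nonempty.2 hne
    exact ⟨_, m, hm, rfl⟩
  obtain ⟨m, hm, hS⟩ := hmem
  refine ⟨m.mapDomain e.symm, mapDomain_mem_support hP e.symm hm, ?_⟩
  rw [hS, ← Equiv.sum_comp e]
  simp only [he]
  rw [Finset.sum_ite_mem, Finset.univ_inter]
  refine Finset.sum_congr rfl fun i _ => ?_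
  simp

end MinDegree

/-! ### The order of the fusion of one cluster -/

section OneCluster

variable {N : ℕ} {P : MvPolynomial (Fin N) ℂ}

/-- The part of `P` of degree `k` in the variables in `A`. -/
noncomputable def partOfDegree (P : MvPolynomial (Fin N) ℂ) (A : Finset (Fin N)) (k : ℕ) :
    MvPolynomial (Fin N) ℂ :=
  ∑ m ∈ P.support with ∑ i ∈ A, m i = k, monomial m (coeff m P)

theorem partOfDegree_ne_zero {A : Finset (Fin N)} {k : ℕ} {m : Fin N →₀ ℕ} (hm : m ∈ P.support)
    (hk : ∑ i ∈ A, m i = k) : partOfDegree P A k ≠ 0 := by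
  intro h0
  have h1 := congrArg (coeff m) h0
  rw [partOfDegree, coeff_sum, coeff_zero] at h1
  simp only [coeff_monomial] at h1
  rw [Finset.sum_ite_eq', if_pos (Finset.mem_filter.2 ⟨hm, hk⟩)] at h1
  exact mem_support_iff.1 hm h1

/-- Each monomial acquires one factor `X` for every degree in the variables of `A`, so only the part
of degree `k` in them can reach `X ^ k`, through the constant terms of the remaining factors. -/
theorem coeff_aeval_of_dvd {A : Finset (Fin N)} {k : ℕ} (hk : ∀ m ∈ P.support, k ≤ ∑ i ∈ A, m i)
    (g u : Fin N → Polynomial ℂ) (hg : ∀ i ∈ A, g i = Polynomial.X * u i) :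
    (∀ j < k, (aeval g P).coeff j = 0) ∧ (aeval g P).coeff k =
      eval (fun i => if i ∈ A then (u i).coeff 0 else (g i).coeff 0) (partOfDegree P A k) := by
  set w : Fin N → Polynomial ℂ := fun i => if i ∈ A then u i else g i with hw
  have hprod : ∀ m : Fin N →₀ ℕ, ∏ i, g i ^ m i =
      Polynomial.X ^ (∑ i ∈ A, m i) * ∏ i, w i ^ m i := by
    intro m
    have h1 : ∀ i, g i ^ m i = (if i ∈ A then Polynomial.X ^ m i else 1) * w i ^ m i := by
      intro i
      by_cases hi : i ∈ A
      · simp [hw, hi, hg i hi, mul_pow]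
      · simp [hw, hi]
    simp only [h1, Finset.prod_mul_distrib]
    rw [Finset.prod_ite_mem, Finset.univ_inter, Finset.prod_pow_eq_pow_sum]
  have hexp : aeval g P = ∑ m ∈ P.support,
      Polynomial.X ^ (∑ i ∈ A, m i) * (Polynomial.C (coeff m P) * ∏ i, w i ^ m i) := by
    rw [aeval_def, eval₂_eq']
    refine Finset.sum_congr rfl fun m _ => ?_
    rw [hprod, Polynomial.algebraMap_eq]
    ring
  rw [hexp]
  refine ⟨fun j hj => ?_, ?_⟩
  · rw [Polynomial.finsetSum_coeff]
    refine Finset.sum_eq_zero fun m hm => ?_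
    rw [Polynomial.coeff_X_pow_mul', if_neg]
    have := hk m hm
    omega
  · rw [Polynomial.finsetSum_coeff, partOfDegree, map_sum, Finset.sum_filter]
    refine Finset.sum_congr rfl fun m hm => ?_
    rw [Polynomial.coeff_X_pow_mul']
    have := hk m hm
    by_cases hmk : ∑ i ∈ A, m i = k
    · rw [if_pos hmk.le, if_pos hmk, hmk, Nat.sub_self, eval_monomial,
        Polynomial.coeff_C_mul, Polynomial.coeff_zero_eq_eval_zero, Polynomial.eval_prod,
        Finsupp.prod_fintype _ _ (by simp)]
      congr 1
      refine Finset.prod_congr rfl fun i _ => ?_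
      rw [Polynomial.eval_pow, ← Polynomial.coeff_zero_eq_eval_zero]
      congr 1
      by_cases hi : i ∈ A <;> simp [hw, hi]
    · rw [if_neg (by omega), if_neg hmk]

theorem aeval_add_of_isTranslationInvariant (hP : IsTranslationInvariant P)
    (g : Fin N → Polynomial ℂ) (c : Polynomial ℂ) : aeval (fun i => g i + c) P = aeval g P := by
  apply Polynomial.funext
  intro t
  rw [eval_aeval_polynomial, eval_aeval_polynomial]
  simpa using hP (c.eval t) fun i => (g i).eval t

theorem fusionExpansion_start {s : Setoid (Fin N)} (h : ⊥ ≤ s) (z : Quotient s → ℂ)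
    (ξ : Quotient (⊥ : Setoid (Fin N)) → ℂ) :
    fusionExpansion h (rename (Quotient.mk ⊥) P) z ξ = aeval (fun i =>
      Polynomial.C (z (Quotient.mk s i)) + Polynomial.X * Polynomial.C (ξ (Quotient.mk ⊥ i))) P := by
  rw [fusionExpansion, aeval_rename]
  rfl

theorem mk_block_eq_iff {A : Finset (Fin N)} {i j : Fin N} :
    (Quotient.mk (twoBlock A ∅) i = Quotient.mk (twoBlock A ∅) j) ↔ i = j ∨ (i ∈ A ∧ j ∈ A) := by
  simp [mk_twoBlock_eq_iff' (Finset.disjoint_empty_right A)]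

theorem IsCentered.eq_zero_of_notMem {A : Finset (Fin N)}
    {ξ : Quotient (⊥ : Setoid (Fin N)) → ℂ} (hξ : IsCentered (twoBlock A ∅) ξ) {i : Fin N}
    (hi : i ∉ A) : ξ (Quotient.mk ⊥ i) = 0 := by
  apply hξ.eq_zero_of_fiber bot_le
  intro y
  induction y using Quotient.inductionOn with | _ j
  intro hj
  change Quotient.mk (twoBlock A ∅) j = Quotient.mk (twoBlock A ∅) i at hj
  rw [mk_block_eq_iff] at hj
  rcases hj with rfl | h
  · rfl
  · exact absurd h.2 hi

/-- After a translation the cluster sits at the origin and its variables become `lam * ξ_i`, so the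
expansion starts with the part of `P` of degree `S_a` in them. What needs proof is that this part
does not vanish identically on centered `ξ`. -/
theorem order_block_eq_S (hsym : P.IsSymmetric) (htr : IsTranslationInvariant P) (hne : P ≠ 0)
    {A : Finset (Fin N)} (hA : A.Nonempty) {Q : MvPolynomial (Quotient (twoBlock A ∅)) ℂ} {d : ℕ}
    (hQ : IsStepOfOrder bot_le (rename (Quotient.mk ⊥) P) Q d) : d = S P A.card := by
  classical
  obtain ⟨a, ha⟩ := hA
  have hmin : ∀ m ∈ P.support, S P A.card ≤ ∑ i ∈ A, m i := fun m hm => S_le hsym A hm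
  set k := S P A.card with hk
  have hexp : ∀ (z : Quotient (twoBlock A ∅) → ℂ) (ξ : Quotient (⊥ : Setoid (Fin N)) → ℂ),
      IsCentered (twoBlock A ∅) ξ →
      (∀ j < k, (fusionExpansion bot_le (rename (Quotient.mk ⊥) P) z ξ).coeff j = 0) ∧
      (fusionExpansion bot_le (rename (Quotient.mk ⊥) P) z ξ).coeff k = eval (fun i =>
        if i ∈ A then ξ (Quotient.mk ⊥ i) else z (Quotient.mk _ i) - z (Quotient.mk _ a))
        (partOfDegree P A k) := by
    intro z ξ hξ
    rw [fusionExpansion_start, ← aeval_add_of_isTranslationInvariant htr _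
      (Polynomial.C (-z (Quotient.mk _ a)))]
    have h1 := coeff_aeval_of_dvd hmin (fun i => Polynomial.C (z (Quotient.mk _ i)) +
      Polynomial.X * Polynomial.C (ξ (Quotient.mk ⊥ i)) + Polynomial.C (-z (Quotient.mk _ a)))
      (fun i => Polynomial.C (ξ (Quotient.mk ⊥ i))) (by
        intro i hi
        have : Quotient.mk (twoBlock A ∅) i = Quotient.mk _ a := mk_block_eq_iff.2 (Or.inr ⟨hi, ha⟩)
        rw [this, map_neg]
        ring)
    refine ⟨h1.1, h1.2.trans ?_⟩
    congr 2
    funext i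
    by_cases hi : i ∈ A <;> simp [hi, sub_eq_add_neg]
  obtain ⟨R, hR, z, ξ, hξ, hne'⟩ := hQ
  apply le_antisymm
  · by_contra! hlt
    have hzero : ∀ w : Fin N → ℂ, eval w (partOfDegree P A k) = 0 := by
      intro w
      -- Subtracting `lam * c`, with `c` the mean over `A`, from all variables makes the
      -- displacements centered. Outside `A` it only affects higher powers of `lam`, so the lowest
      -- coefficient at `w` is unchanged.
      set c : ℂ := (∑ i ∈ A, w i) / A.card with hc
      have hcard : (A.card : ℂ) ≠ 0 := by
        exact_mod_cast (Finset.card_pos.2 ⟨a, ha⟩).ne'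
      let ξ' : Quotient (⊥ : Setoid (Fin N)) → ℂ :=
        Quotient.lift (fun i => if i ∈ A then w i - c else 0) (by
          intro i j (hij : i = j)
          rw [hij])
      let z' : Quotient (twoBlock A ∅) → ℂ :=
        Quotient.lift (fun i => if i ∈ A then 0 else w i) (by
          intro i j hij
          rcases mk_block_eq_iff.1 (Quotient.sound hij) with rfl | h
          · rfl
          · simp [h.1, h.2])
      have hξ' : IsCentered (twoBlock A ∅) ξ' := by
        intro y
        induction y using Quotient.inductionOn with | _ j
        simp only [mk_block_eq_iff, ξ', Quotient.lift_mk]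
        by_cases hj : j ∈ A
        · have h1 : ∀ i, (if i = j ∨ (i ∈ A ∧ j ∈ A) then (if i ∈ A then w i - c else 0) else 0) =
              if i ∈ A then w i - c else 0 := by
            intro i
            by_cases hi : i ∈ A <;> simp [hi, hj]
          simp only [h1]
          rw [Finset.sum_ite_mem, Finset.univ_inter, Finset.sum_sub_distrib, Finset.sum_const,
            nsmul_eq_mul, hc]
          field_simp
          ring
        · refine Finset.sum_eq_zero fun i _ => ?_
          by_cases hi : i = j
          · simp [hi, hj]
          · simp [hi, hj]
      have h1 := (hexp z' ξ' hξ').2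
      rw [(hR z' ξ' hξ').1 _ hlt] at h1
      have h2 := coeff_aeval_of_dvd hmin
        (fun i => if i ∈ A then Polynomial.X * Polynomial.C (w i) else Polynomial.C (w i))
        (fun i => Polynomial.C (w i)) (by intro i hi; simp only [hi, if_true])
      have h3 := coeff_aeval_of_dvd hmin
        (fun i => (if i ∈ A then Polynomial.X * Polynomial.C (w i) else Polynomial.C (w i)) +
          Polynomial.X * Polynomial.C (-c))
        (fun i => Polynomial.C (w i - c)) (by
          intro i hi
          simp only [hi, if_true, map_sub, map_neg]
          ring)
      rw [aeval_add_of_isTranslationInvariant htr, h2.2] at h3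
      have h4 := h3.2
      have e1 : (fun i => if i ∈ A then (Polynomial.C (w i)).coeff 0 else
          (if i ∈ A then Polynomial.X * Polynomial.C (w i) else Polynomial.C (w i)).coeff 0) = w := by
        funext i
        by_cases hi : i ∈ A <;> simp [hi]
      rw [e1] at h4
      rw [h4, h1]
      congr 2
      funext i
      by_cases hi : i ∈ A <;> simp [hi, ξ', z', ha]
    obtain ⟨m, hm, hmk⟩ := exists_sum_eq_S hsym hne A
    exact partOfDegree_ne_zero hm hmk (MvPolynomial.funext fun w => by rw [hzero w, map_zero])
  · by_contra! hlt
    exact hne' ((hR z ξ hξ).2 ▸ (hexp z ξ hξ).1 d hlt)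

theorem exists_step_block (hP : IsAdmissible P) {A : Finset (Fin N)} (hA : A.Nonempty) :
    ∃ Q : MvPolynomial (Quotient (twoBlock A ∅)) ℂ,
      (FusionProcess.fuse .start (twoBlock A ∅) bot_le).IsDerived P Q ∧
      IsStepOfOrder bot_le (rename (Quotient.mk ⊥) P) Q (S P A.card) := by
  obtain ⟨Q, hQ⟩ := hP.ufc.1 _ (.fuse .start (twoBlock A ∅) bot_le)
  have hQ' := hQ
  obtain ⟨Q₀, hQ₀, hstep⟩ := hQ'
  obtain rfl : Q₀ = rename (Quotient.mk ⊥) P := hQ₀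
  obtain ⟨d, hd⟩ := isDerivedStep_iff.1 hstep
  have := order_block_eq_S hP.symmetric hP.translationInvariant hP.ufc.ne_zero hA hd
  exact ⟨Q, hQ, this ▸ hd⟩

theorem hasTotalOrder_block (hP : IsAdmissible P) {e : ℕ} (he : P.IsHomogeneous e)
    {A : Finset (Fin N)} (hA : A.Nonempty) : HasTotalOrder P e (twoBlock A ∅) (S P A.card) := by
  obtain ⟨Q, hQ, hstep⟩ := exists_step_block hP hA
  exact ⟨_, Q, hQ, by
    simpa using (ScalesBy.of_isHomogeneous he.rename_isHomogeneous).step hstep⟩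

/-! ### The recursion for the numbers `S_a` -/

theorem exists_card_eq {a : ℕ} (ha : a ≤ N) : ∃ A : Finset (Fin N), A.card = a := by
  obtain ⟨A, -, hA⟩ := Finset.exists_subset_card_eq (s := (Finset.univ : Finset (Fin N))) (n := a)
    (by simpa using ha)
  exact ⟨A, hA⟩

theorem exists_disjoint_card_eq {a b : ℕ} (hab : a + b ≤ N) :
    ∃ A B : Finset (Fin N), Disjoint A B ∧ A.card = a ∧ B.card = b := by
  obtain ⟨A, hA⟩ := exists_card_eq (N := N) (a := a) (by omega)
  obtain ⟨B, hB, hB'⟩ := Finset.exists_subset_card_eq (s := Aᶜ) (n := b) (by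
    rw [Finset.card_compl, Fintype.card_fin]
    omega)
  exact ⟨A, B, (Finset.subset_compl_iff_disjoint_left.1 hB), hA, hB'⟩

theorem S_one (hP : IsAdmissible P) (hN : 0 < N) : S P 1 = 0 := by
  obtain ⟨e, he⟩ := hP.homogeneous
  have h1 := hasTotalOrder_block hP he (A := {⟨0, hN⟩}) (by simp)
  rw [twoBlock_singleton_empty, Finset.card_singleton] at h1
  exact h1.unique hP.ufc (hasTotalOrder_bot he)

/-- The cluster of `a + 1` particles is formed in one step, or by adding one particle to a cluster
of `a`; the total orders agree. -/
theorem S_succ (hP : IsAdmissible P) {a D : ℕ} (ha : 0 < a) (haN : a + 1 ≤ N)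
    (hD : HasLocalOrder P a 1 D) : S P (a + 1) = S P a + D := by
  obtain ⟨e, he⟩ := hP.homogeneous
  obtain ⟨A, B, hAB, rfl, hB⟩ := exists_disjoint_card_eq haN
  obtain ⟨j, rfl⟩ := Finset.card_eq_one.1 hB
  have hj : j ∉ A := by simpa using hAB
  have hA : A.Nonempty := Finset.card_pos.1 ha
  have h1 := hasTotalOrder_block hP he hA
  rw [← twoBlock_singleton_right A hj] at h1
  have h2 := h1.union hAB hA (by simp) (by simpa using hD)
  have h3 := hasTotalOrder_block hP he (A := A ∪ {j}) (by simp)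
  have hcard : (A ∪ {j}).card = A.card + 1 := by
    rw [Finset.card_union_of_disjoint hAB, Finset.card_singleton]
  rw [hcard] at h3
  exact h3.unique hP.ufc h2

/-- The second cluster grows one particle at a time; by `S_succ` the orders telescope to `S P
B.card`. -/
theorem hasTotalOrder_twoBlock (hP : IsAdmissible P) {e : ℕ} (he : P.IsHomogeneous e)
    {A B : Finset (Fin N)} (hAB : Disjoint A B) (hA : A.Nonempty) (hB : B.Nonempty) :
    HasTotalOrder P e (twoBlock A B) (S P A.card + S P B.card) := by
  induction hB using Finset.Nonempty.cons_induction with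
  | singleton j =>
    have hj : j ∉ A := by simpa using hAB
    have hN : 0 < N := j.pos
    rw [twoBlock_singleton_right A hj, Finset.card_singleton, S_one hP hN, add_zero]
    exact hasTotalOrder_block hP he hA
  | cons j B hj hB ih =>
    rw [Finset.cons_eq_insert] at hAB ⊢
    obtain ⟨hjA, hAB⟩ := Finset.disjoint_insert_right.1 hAB
    obtain ⟨D, hD⟩ := hP.ulc B.card 1
    have hcard := Finset.card_insert_of_notMem hj
    have hle : B.card + 1 ≤ N := by
      rw [← hcard]
      simpa using (insert j B).card_le_univ
    rw [hcard, S_succ hP (Finset.card_pos.2 hB) hle hD, ← add_assoc]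
    exact (ih hAB).insert_right hAB hB hjA hj hD

theorem S_add (hP : IsAdmissible P) {a b D : ℕ} (ha : 0 < a) (hb : 0 < b) (hab : a + b ≤ N)
    (hD : HasLocalOrder P a b D) : S P (a + b) = S P a + S P b + D := by
  obtain ⟨e, he⟩ := hP.homogeneous
  obtain ⟨A, B, hAB, rfl, rfl⟩ := exists_disjoint_card_eq hab
  have hA : A.Nonempty := Finset.card_pos.1 ha
  have hB : B.Nonempty := Finset.card_pos.1 hb
  have h2 := (hasTotalOrder_twoBlock hP he hAB hA hB).union hAB hA hB hD
  have h3 := hasTotalOrder_block hP he (A := A ∪ B) (hA.mono Finset.subset_union_left)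
  rw [Finset.card_union_of_disjoint hAB] at h3
  exact h3.unique hP.ufc h2

theorem S_zero (hP : P ≠ 0) : S P 0 = 0 := by
  obtain ⟨m, hm⟩ := support_nonempty.2 hP
  exact Nat.le_zero.1 (Nat.sInf_le ⟨m, hm, by simp⟩)

theorem sum_eq_of_isHomogeneous {e : ℕ} (he : P.IsHomogeneous e) {m : Fin N →₀ ℕ}
    (hm : m ∈ P.support) : ∑ i, m i = e := by
  rw [← he (mem_support_iff.1 hm), Finsupp.weight_apply, Finsupp.sum_fintype _ _ (by simp)]
  simp

theorem S_card_univ (hsym : P.IsSymmetric) (hP : P ≠ 0) {e : ℕ} (he : P.IsHomogeneous e) :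
    S P N = e := by
  obtain ⟨m, hm, hS⟩ := exists_sum_eq_S hsym hP Finset.univ
  rw [sum_eq_of_isHomogeneous he hm] at hS
  simpa using hS.symm

/-! ### The degree in the variable of a cluster -/

open Classical in
/-- `Q` as a polynomial in the variable `x`, the other variables taking the values `z`. -/
noncomputable def slice {σ : Type*} (Q : MvPolynomial σ ℂ) (x : σ) (z : σ → ℂ) : Polynomial ℂ :=
  aeval (Function.update (fun y => Polynomial.C (z y)) x Polynomial.X) Q

theorem eval_slice {σ : Type*} [DecidableEq σ] (Q : MvPolynomial σ ℂ) (x : σ) (z : σ → ℂ) (u : ℂ) :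
    (slice Q x z).eval u = eval (Function.update z x u) Q := by
  rw [slice, eval_aeval_polynomial]
  congr 2
  funext y
  by_cases hy : y = x
  · subst hy; simp
  · simp [hy]

/-- With the new particle at `u` and `lam = u * μ`, the fused variables become `u * (1 + μ * ξ_i)`,
so a monomial contributes `u` to its degree in `A`, at most `M`. Returning from `μ ^ k` to `lam ^ k`
costs `u ^ k`. -/
theorem natDegree_slice_le {A : Finset (Fin N)} {a : Fin N} (ha : a ∈ A)
    {Q : MvPolynomial (Quotient (twoBlock A ∅)) ℂ} {k M : ℕ}
    (hQ : IsStepOfOrder bot_le (rename (Quotient.mk ⊥) P) Q k)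
    (hM : ∀ m ∈ P.support, ∑ i ∈ A, m i ≤ M) (z : Quotient (twoBlock A ∅) → ℂ) :
    (slice Q (Quotient.mk _ a) z).natDegree ≤ M - k := by
  classical
  obtain ⟨ξ, c, hξ, hc, hcoeff⟩ := hQ.exists_centered
  let w : Fin N → Polynomial ℂ := fun i => if i ∈ A then
    1 + Polynomial.X * Polynomial.C (ξ (Quotient.mk ⊥ i)) else Polynomial.C (z (Quotient.mk _ i))
  let κ : (Fin N →₀ ℕ) → ℂ := fun m => coeff m P * (∏ i, w i ^ m i).coeff k
  have hcomp : ∀ u : ℂ, (fusionExpansion bot_le (rename (Quotient.mk ⊥) P)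
      (Function.update z (Quotient.mk _ a) u) ξ).comp (Polynomial.C u * Polynomial.X) =
      ∑ m ∈ P.support, Polynomial.C (u ^ (∑ i ∈ A, m i) * coeff m P) * ∏ i, w i ^ m i := by
    intro u
    have h1 : (fusionExpansion bot_le (rename (Quotient.mk ⊥) P)
        (Function.update z (Quotient.mk _ a) u) ξ).comp (Polynomial.C u * Polynomial.X) =
        aeval (fun i => (if i ∈ A then Polynomial.C u else 1) * w i) P := by
      apply Polynomial.funext
      intro t
      rw [Polynomial.eval_comp, eval_fusionExpansion, eval_rename, eval_aeval_polynomial]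
      congr 2
      funext i
      simp only [Function.comp_apply]
      change Function.update z _ u (Quotient.mk (twoBlock A ∅) i) + _ = _
      by_cases hi : i ∈ A
      · rw [mk_block_eq_iff.2 (Or.inr ⟨hi, ha⟩)]
        simp [w, hi]
        ring
      · rw [Function.update_of_ne, hξ.eq_zero_of_notMem hi]
        · simp [w, hi]
        · rw [Ne, mk_block_eq_iff]
          rintro (rfl | h)
          · exact hi ha
          · exact hi h.1
    rw [h1, aeval_def, eval₂_eq']
    refine Finset.sum_congr rfl fun m _ => ?_
    simp only [mul_pow, Finset.prod_mul_distrib]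
    have h2 : ∏ i, (if i ∈ A then Polynomial.C u else (1 : Polynomial ℂ)) ^ m i =
        Polynomial.C (u ^ (∑ i ∈ A, m i)) := by
      simp only [ite_pow, one_pow]
      rw [Finset.prod_ite_mem, Finset.univ_inter, Finset.prod_pow_eq_pow_sum, map_pow]
    rw [h2, Polynomial.algebraMap_eq, map_mul]
    ring
  have hpoly : Polynomial.C c * (Polynomial.X ^ k * slice Q (Quotient.mk _ a) z) =
      ∑ m ∈ P.support, Polynomial.C (κ m) * Polynomial.X ^ (∑ i ∈ A, m i) := by
    apply Polynomial.funext
    intro u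
    have h1 := congrArg (fun p => Polynomial.coeff p k) (hcomp u)
    simp only [Polynomial.comp_C_mul_X_coeff, Polynomial.finsetSum_coeff,
      Polynomial.coeff_C_mul] at h1
    rw [(hcoeff _).2] at h1
    simp only [Polynomial.eval_mul, Polynomial.eval_C, Polynomial.eval_pow, Polynomial.eval_X,
      eval_slice, Polynomial.eval_finsetSum]
    have h2 : ∑ m ∈ P.support, κ m * u ^ (∑ i ∈ A, m i) =
        ∑ m ∈ P.support, u ^ (∑ i ∈ A, m i) * coeff m P * (∏ i, w i ^ m i).coeff k :=
      Finset.sum_congr rfl fun m _ => by simp only [κ]; ring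
    rw [h2, ← h1]
    ring
  by_cases h0 : slice Q (Quotient.mk _ a) z = 0
  · simp [h0]
  have hdeg : (Polynomial.C c * (Polynomial.X ^ k * slice Q (Quotient.mk _ a) z)).natDegree ≤ M := by
    rw [hpoly]
    refine Polynomial.natDegree_sum_le_of_forall_le _ _ fun m hm => ?_
    exact (Polynomial.natDegree_C_mul_X_pow_le _ _).trans (hM m hm)
  rw [Polynomial.natDegree_C_mul hc, Polynomial.natDegree_mul (by simp) h0,
    Polynomial.natDegree_X_pow] at hdeg
  omega

end OneCluster

/-! ### Inversion symmetry -/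

/-- Clearing denominators turns the hypothesis into `p * X ^ q.natDegree = q.reverse`; the
coefficients at `q.natDegree` are the two constant terms. -/
theorem coeff_zero_eq_of_eval_eq_eval_inv {p q : Polynomial ℂ} {s : Set ℂ} (hs : s.Infinite)
    (h : ∀ c ∈ s, c ≠ 0 → p.eval c = q.eval c⁻¹) : p.coeff 0 = q.coeff 0 := by
  have key : p * Polynomial.X ^ q.natDegree = q.reverse := by
    refine Polynomial.eq_of_infinite_eval_eq _ _
      ((hs.sdiff (Set.finite_singleton (0 : ℂ))).mono ?_)
    rintro c ⟨hc, hc0⟩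
    have hc0 : c ≠ 0 := hc0
    change _ = _
    let _ : Invertible c⁻¹ := invertibleOfNonzero (inv_ne_zero hc0)
    have h1 := Polynomial.eval₂_reverse_mul_pow (RingHom.id ℂ) c⁻¹ q
    rw [invOf_eq_inv, inv_inv] at h1
    rw [Polynomial.eval_mul, Polynomial.eval_pow, Polynomial.eval_X, h c hc hc0]
    change Polynomial.eval c q.reverse * _ = Polynomial.eval _ q at h1
    rw [← h1, mul_assoc, ← mul_pow, inv_mul_cancel₀ hc0, one_pow, mul_one]
  have h1 := congrArg (fun p => Polynomial.coeff p q.natDegree) key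
  simpa [Polynomial.coeff_mul_X_pow', Polynomial.coeff_reverse, Polynomial.revAt_le] using h1

section Inversion

variable {N : ℕ} {P : MvPolynomial (Fin N) ℂ}

theorem le_maxDegree {m : Fin N →₀ ℕ} (hm : m ∈ P.support) (i : Fin N) : m i ≤ maxDegree P :=
  (monomial_le_degreeOf i hm).trans
    (Finset.le_sup (f := fun i : Fin N => P.degreeOf i) (Finset.mem_univ i))

/-- `P`, homogenized to degree `d` in every variable. -/
noncomputable def homogenizedEval (P : MvPolynomial (Fin N) ℂ) (d : ℕ) (x y : Fin N → ℂ) : ℂ :=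
  ∑ m ∈ P.support, coeff m P * ∏ i, (x i ^ m i * y i ^ (d - m i))

theorem homogenizedEval_eq {d : ℕ} (hd : ∀ m ∈ P.support, ∀ i, m i ≤ d) {x y : Fin N → ℂ}
    (hy : ∀ i, y i ≠ 0) :
    homogenizedEval P d x y = (∏ i, y i ^ d) * eval (fun i => x i / y i) P := by
  rw [homogenizedEval, eval_eq', Finset.mul_sum]
  refine Finset.sum_congr rfl fun m hm => ?_
  rw [mul_left_comm, ← Finset.prod_mul_distrib]
  congr 1
  refine Finset.prod_congr rfl fun i _ => ?_
  obtain ⟨k, hk⟩ := Nat.exists_eq_add_of_le (hd m hm i)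
  have := hy i
  rw [hk, Nat.add_sub_cancel_left, div_pow, pow_add]
  field_simp

/-- The maps `z ↦ z / (1 + c * z)` are scaled and translated forms of `z ↦ -1 / (z + c⁻¹)`. The
powers of `c` cancel precisely when `2 * e = N * d`, so the transform of `P` is a polynomial both in
`c` and in `c⁻¹`. Its constant terms are `P` and the inversion of `P`. -/
theorem homogenizedEval_inversion (htr : IsTranslationInvariant P) {e d : ℕ}
    (he : P.IsHomogeneous e) (hd : ∀ m ∈ P.support, ∀ i, m i ≤ d) (hN : 2 * e = N * d)
    (z : Fin N → ℂ) : homogenizedEval P d (fun _ => -1) z = eval z P := by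
  let p : Polynomial ℂ := ∑ m ∈ P.support, Polynomial.C (coeff m P) *
    ∏ i, (Polynomial.C (z i) ^ m i * (1 + Polynomial.X * Polynomial.C (z i)) ^ (d - m i))
  let q : Polynomial ℂ := ∑ m ∈ P.support, Polynomial.C (coeff m P) *
    ∏ i, (Polynomial.C (-1) ^ m i * (Polynomial.C (z i) + Polynomial.X) ^ (d - m i))
  have hp : ∀ c, p.eval c = homogenizedEval P d z (fun i => 1 + c * z i) := by
    intro c
    simp only [p, homogenizedEval, Polynomial.eval_finsetSum, Polynomial.eval_mul,
      Polynomial.eval_prod, Polynomial.eval_pow, Polynomial.eval_add, Polynomial.eval_C,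
      Polynomial.eval_X, Polynomial.eval_one]
  have hq : ∀ t, q.eval t = homogenizedEval P d (fun _ => -1) (fun i => z i + t) := by
    intro t
    simp only [q, homogenizedEval, Polynomial.eval_finsetSum, Polynomial.eval_mul,
      Polynomial.eval_prod, Polynomial.eval_pow, Polynomial.eval_add, Polynomial.eval_C,
      Polynomial.eval_X]
  have hinf : {c : ℂ | ∀ i, 1 + c * z i ≠ 0}.Infinite := by
    have hfin : {c : ℂ | ∀ i, 1 + c * z i ≠ 0}ᶜ.Finite := by
      refine (Set.finite_range fun i => -(z i)⁻¹).subset ?_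
      intro c hc
      have : ∃ i, 1 + c * z i = 0 := by
        by_contra! h
        exact hc h
      obtain ⟨i, hi⟩ := this
      have hz : z i ≠ 0 := by
        intro h0
        simp [h0] at hi
      refine ⟨i, ?_⟩
      change -(z i)⁻¹ = c
      field_simp
      linear_combination -hi
    exact hfin.infinite_compl.mono (by rw [compl_compl])
  have hpq : p.coeff 0 = q.coeff 0 := by
    refine coeff_zero_eq_of_eval_eq_eval_inv hinf fun c hc hc0 => ?_
    have hc : ∀ i, 1 + c * z i ≠ 0 := hc
    have hc' : ∀ i, z i + c⁻¹ ≠ 0 := by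
      intro i h0
      apply hc i
      have : 1 + c * z i = c * (z i + c⁻¹) := by field_simp; ring
      rw [this, h0, mul_zero]
    rw [hp, hq, homogenizedEval_eq hd hc, homogenizedEval_eq hd hc']
    have h1 : ∏ i, (1 + c * z i) ^ d = c ^ (2 * e) * ∏ i, (z i + c⁻¹) ^ d := by
      rw [hN, pow_mul', show (c ^ d) ^ N = ∏ _i : Fin N, c ^ d by simp, ← Finset.prod_mul_distrib]
      refine Finset.prod_congr rfl fun i _ => ?_
      rw [← mul_pow]
      congr 1
      field_simp
      ring
    -- The Möbius map is written as inversion, scaling by `c⁻¹ ^ 2` and translation by `c⁻¹`;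
    -- homogeneity and translation invariance handle the last two.
    have h2 : (fun i => z i / (1 + c * z i)) =
        fun i => (c⁻¹ ^ 2 * (-1 / (z i + c⁻¹))) + c⁻¹ := by
      funext i
      have h3 := hc i
      have h4 := hc' i
      have h5 : z i + c⁻¹ = c⁻¹ * (1 + c * z i) := by field_simp; ring
      have h6 : z i = (1 + c * z i - 1) / c := by field_simp; ring
      rw [h5]
      generalize 1 + c * z i = y at h3 h6
      rw [h6]
      field_simp
      ring
    rw [h2, htr]
    have h3 := ScalesBy.of_isHomogeneous he (c⁻¹ ^ 2) fun i => -1 / (z i + c⁻¹)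
    rw [pow_zero, one_mul] at h3
    rw [h3, h1]
    have : c ^ (2 * e) * (c⁻¹ ^ 2) ^ e = 1 := by
      rw [← pow_mul, ← mul_pow, mul_inv_cancel₀ hc0, one_pow]
    linear_combination (∏ i, (z i + c⁻¹) ^ d) * (eval fun i => -1 / (z i + c⁻¹)) P * this
  rw [Polynomial.coeff_zero_eq_eval_zero, Polynomial.coeff_zero_eq_eval_zero, hp, hq] at hpq
  simp only [zero_mul, add_zero] at hpq
  rw [← hpq, homogenizedEval_eq hd (by simp)]
  simp

theorem reverse_mem_support (htr : IsTranslationInvariant P) {e d : ℕ}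
    (he : P.IsHomogeneous e) (hd : ∀ m ∈ P.support, ∀ i, m i ≤ d) (hN : 2 * e = N * d)
    {m : Fin N →₀ ℕ} (hm : m ∈ P.support) :
    Finsupp.equivFunOnFinite.symm (fun i => d - m i) ∈ P.support := by
  let rev : (Fin N →₀ ℕ) → (Fin N →₀ ℕ) := fun m =>
    Finsupp.equivFunOnFinite.symm (fun i => d - m i)
  have hP : P = ∑ m ∈ P.support, monomial (rev m) (coeff m P * ∏ i, (-1) ^ m i) := by
    apply MvPolynomial.funext
    intro z
    rw [← homogenizedEval_inversion htr he hd hN z, homogenizedEval, map_sum]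
    refine Finset.sum_congr rfl fun m _ => ?_
    rw [eval_monomial, Finsupp.prod_fintype _ _ (by simp), Finset.prod_mul_distrib]
    simp only [rev, Finsupp.equivFunOnFinite_symm_apply_apply]
    ring
  -- Distinct exponents have distinct complements, so no terms of the inverted polynomial cancel.
  have hinj : ∀ m' ∈ P.support, rev m' = rev m → m' = m := by
    intro m' hm' h
    ext i
    have h1 := DFunLike.congr_fun h i
    simp only [rev, Finsupp.equivFunOnFinite_symm_apply_apply] at h1
    have := hd m hm i
    have := hd m' hm' i
    omega
  change rev m ∈ P.support
  rw [mem_support_iff, hP, coeff_sum]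
  simp only [coeff_monomial]
  rw [Finset.sum_eq_single m]
  · rw [if_pos rfl]
    refine mul_ne_zero (mem_support_iff.1 hm) ?_
    exact Finset.prod_ne_zero_iff.2 fun i _ => pow_ne_zero _ (by norm_num)
  · intro m' hm' hne
    rw [if_neg fun h => hne (hinj m' hm' h)]
  · exact fun h => absurd hm h

theorem IsAMS.two_mul_degree (hP : IsAMS P) {e : ℕ} (he : P.IsHomogeneous e) :
    2 * e = N * maxDegree P := by
  have h := hP.J_eq_zero
  rw [J, S_card_univ hP.symmetric hP.ufc.ne_zero he] at h
  have : (2 * e : ℚ) = N * maxDegree P := by linarith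
  exact_mod_cast this

theorem IsAMS.sum_add_S_le (hP : IsAMS P) (A : Finset (Fin N)) {m : Fin N →₀ ℕ}
    (hm : m ∈ P.support) : ∑ i ∈ A, m i + S P A.card ≤ A.card * maxDegree P := by
  obtain ⟨e, he⟩ := hP.homogeneous
  have h1 := S_le hP.symmetric A (reverse_mem_support hP.translationInvariant he
    (fun m hm i => le_maxDegree hm i) (hP.two_mul_degree he) hm)
  simp only [Finsupp.equivFunOnFinite_symm_apply_apply] at h1
  have h2 : ∑ i ∈ A, (maxDegree P - m i) + ∑ i ∈ A, m i = A.card * maxDegree P := by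
    rw [← Finset.sum_add_distrib, Finset.sum_congr rfl fun i _ =>
      Nat.sub_add_cancel (le_maxDegree hm i)]
    simp
  omega

/-- Complementing a monomial of least degree on `A` gives one of greatest degree on `A`, hence, the
total being `e`, one of least degree on `Aᶜ`. -/
theorem IsAMS.S_sub (hP : IsAMS P) {e : ℕ} (he : P.IsHomogeneous e) {a : ℕ} (ha : a ≤ N) :
    S P (N - a) + a * maxDegree P = e + S P a := by
  obtain ⟨A, rfl⟩ := exists_card_eq ha
  have hcard : Aᶜ.card = N - A.card := by rw [Finset.card_compl, Fintype.card_fin]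
  rw [← hcard]
  have hsplit : ∀ m ∈ P.support, ∑ i ∈ A, m i + ∑ i ∈ Aᶜ, m i = e := fun m hm => by
    rw [Finset.sum_add_sum_compl, sum_eq_of_isHomogeneous he hm]
  have hne := hP.ufc.ne_zero
  obtain ⟨m, hm, hmS⟩ := exists_sum_eq_S hP.symmetric hne Aᶜ
  have h1 := hP.sum_add_S_le A hm
  have h2 := hsplit m hm
  obtain ⟨m', hm', hmS'⟩ := exists_sum_eq_S hP.symmetric hne A
  have hrev := reverse_mem_support hP.translationInvariant he
    (fun m hm i => le_maxDegree hm i) (hP.two_mul_degree he) hm'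
  have h3 := S_le hP.symmetric Aᶜ hrev
  have h4 := hsplit _ hrev
  simp only [Finsupp.equivFunOnFinite_symm_apply_apply] at h3 h4
  have h5 : ∑ i ∈ A, (maxDegree P - m' i) + ∑ i ∈ A, m' i = A.card * maxDegree P := by
    rw [← Finset.sum_add_distrib, Finset.sum_congr rfl fun i _ =>
      Nat.sub_add_cancel (le_maxDegree hm' i)]
    simp
  omega

end Inversion

/-! ### Polynomials not depending on a variable -/

section Specialize

variable {σ : Type*}

open Classical in
/-- `Q` with the value `u` substituted for the variable `x`. -/
noncomputable def substVar (Q : MvPolynomial σ ℂ) (x : σ) (u : ℂ) : MvPolynomial σ ℂ :=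
  bind₁ (Function.update X x (C u)) Q

theorem eval_substVar (Q : MvPolynomial σ ℂ) (x : σ) (u : ℂ) (z : σ → ℂ) :
    eval z (substVar Q x u) = (slice Q x z).eval u := by
  classical
  rw [eval_slice, substVar, ← coe_aeval_eq_eval, RingHom.coe_coe, aeval_bind₁, ← coe_aeval_eq_eval,
    RingHom.coe_coe]
  congr 2
  funext y
  by_cases hy : y = x
  · subst hy; simp
  · simp [hy]

theorem notMem_vars_substVar (Q : MvPolynomial σ ℂ) (x : σ) (u : ℂ) :
    x ∉ (substVar Q x u).vars := by
  classical
  intro h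
  obtain ⟨y, -, hy⟩ := mem_vars_bind₁ _ _ h
  by_cases hyx : y = x
  · subst hyx
    simp at hy
  · rw [Function.update_of_ne hyx, vars_X, Finset.mem_singleton] at hy
    exact hyx hy.symm

theorem exists_substVar_ne_zero {Q : MvPolynomial σ ℂ} (hQ : Q ≠ 0) (x : σ) :
    ∃ u, substVar Q x u ≠ 0 := by
  classical
  obtain ⟨z, hz⟩ := exists_eval_ne_zero hQ
  refine ⟨z x, fun h0 => hz ?_⟩
  have h1 := eval_substVar Q x (z x) z
  rwa [h0, map_zero, eval_slice, Function.update_eq_self, eq_comm] at h1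

theorem eval_slice_self (Q : MvPolynomial σ ℂ) (x : σ) (z : σ → ℂ) :
    (slice Q x z).eval (z x) = eval z Q := by
  classical
  rw [eval_slice, Function.update_eq_self]

theorem eval_slice_of_notMem_vars {Q : MvPolynomial σ ℂ} {x : σ} (hx : x ∉ Q.vars) (z : σ → ℂ)
    (u : ℂ) : (slice Q x z).eval u = eval z Q := by
  classical
  rw [eval_slice]
  refine eval₂Hom_congr' rfl ?_ rfl
  intro i hi _
  rw [Function.update_of_ne]
  rintro rfl
  exact hx hi

theorem emultiplicity_X_sub_X_of_notMem_vars {Q : MvPolynomial σ ℂ} {x y : σ} (hx : x ∉ Q.vars)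
    (hQ : Q ≠ 0) : emultiplicity (X x - X y) Q = 0 := by
  classical
  rw [emultiplicity_eq_zero]
  intro hdvd
  apply hQ
  apply MvPolynomial.funext
  intro z
  obtain ⟨G, rfl⟩ := hdvd
  by_cases hxy : x = y
  · subst hxy; simp
  rw [← eval_slice_of_notMem_vars hx z (z y), eval_slice]
  simp [Function.update_of_ne (Ne.symm hxy)]

theorem slice_pow (Q : MvPolynomial σ ℂ) (x : σ) (z : σ → ℂ) (n : ℕ) :
    slice (Q ^ n) x z = slice Q x z ^ n := by
  simp [slice]

theorem slice_mul (Q Q' : MvPolynomial σ ℂ) (x : σ) (z : σ → ℂ) :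
    slice (Q * Q') x z = slice Q x z * slice Q' x z := by
  simp [slice]

theorem slice_C_mul (c : ℂ) (Q : MvPolynomial σ ℂ) (x : σ) (z : σ → ℂ) :
    slice (C c * Q) x z = Polynomial.C c * slice Q x z := by
  simp [slice]

end Specialize

/-! ### Polynomials that factor at a particle -/

section FactorsAt

variable {N : ℕ} {r : Setoid (Fin N)}

open Classical in
/-- The product of `(u - z_y) ^ (m * type of y)` over all particles `y` other than `x`. -/
noncomputable def otherProd (m : ℕ) (x : Quotient r) (z : Quotient r → ℂ) (u : ℂ) : ℂ :=
  ∏ i : Fin N, if Quotient.mk r i = x then 1 else (u - z (Quotient.mk r i)) ^ m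

/-- `Q` is the product of `(z_x - z_y) ^ (m * type of y)` over all particles `y` other than `x`, up
to a factor that does not depend on `z_x`. -/
def FactorsAt (m : ℕ) (x : Quotient r) (Q : MvPolynomial (Quotient r) ℂ) : Prop :=
  ∀ (z : Quotient r → ℂ) (u v : ℂ), (slice Q x z).eval u * otherProd m x z v =
    (slice Q x z).eval v * otherProd m x z u

open Classical in
/-- `otherProd` as a polynomial in `z`. -/
noncomputable def otherPoly (m : ℕ) (x : Quotient r) (u : ℂ) : MvPolynomial (Quotient r) ℂ :=
  ∏ i : Fin N, if Quotient.mk r i = x then 1 else (C u - X (Quotient.mk r i)) ^ m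

theorem eval_otherPoly (m : ℕ) (x : Quotient r) (u : ℂ) (z : Quotient r → ℂ) :
    eval z (otherPoly m x u) = otherProd m x z u := by
  classical
  rw [otherPoly, otherProd, map_prod]
  refine Finset.prod_congr rfl fun i _ => ?_
  split_ifs <;> simp

theorem C_sub_X_ne_zero {σ : Type*} (u : ℂ) (y : σ) : (C u - X y : MvPolynomial σ ℂ) ≠ 0 := by
  intro h0
  have h1 := congrArg (eval fun _ => u + 1) h0
  simp at h1

theorem otherPoly_ne_zero (m : ℕ) (x : Quotient r) (u : ℂ) : otherPoly m x u ≠ 0 := by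
  classical
  rw [otherPoly, Finset.prod_ne_zero_iff]
  intro i _
  split_ifs
  · exact one_ne_zero
  · exact pow_ne_zero _ (C_sub_X_ne_zero u _)

theorem otherProd_update (m : ℕ) (x : Quotient r) (z : Quotient r → ℂ) (u v : ℂ)
    [DecidableEq (Quotient r)] :
    otherProd m x (Function.update z x v) u = otherProd m x z u := by
  refine Finset.prod_congr rfl fun i _ => ?_
  by_cases hi : Quotient.mk r i = x
  · simp [hi]
  · simp [hi]

theorem substVar_otherPoly (m : ℕ) (x : Quotient r) (u v : ℂ) :
    substVar (otherPoly m x u) x v = otherPoly m x u := by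
  classical
  apply MvPolynomial.funext
  intro z
  rw [eval_substVar, eval_slice, eval_otherPoly, eval_otherPoly, otherProd_update]

theorem notMem_vars_otherPoly (m : ℕ) (x : Quotient r) (u : ℂ) : x ∉ (otherPoly m x u).vars := by
  rw [← substVar_otherPoly m x u 0]
  exact notMem_vars_substVar _ _ _

theorem FactorsAt.of_generic {m : ℕ} {x : Quotient r} {Q D : MvPolynomial (Quotient r) ℂ}
    (hD : D ≠ 0) (h : ∀ z, eval z D ≠ 0 → ∀ u v : ℂ, (slice Q x z).eval u * otherProd m x z v =
      (slice Q x z).eval v * otherProd m x z u) : FactorsAt m x Q := by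
  intro z u v
  have key : substVar Q x u * otherPoly m x v = substVar Q x v * otherPoly m x u := by
    refine eq_of_eval_eq_of_eval_ne_zero hD fun z hz => ?_
    simpa only [map_mul, eval_substVar, eval_otherPoly] using h z hz u v
  simpa only [map_mul, eval_substVar, eval_otherPoly] using congrArg (eval z) key

theorem FactorsAt.C_mul {m : ℕ} {x : Quotient r} {Q : MvPolynomial (Quotient r) ℂ}
    (h : FactorsAt m x Q) (c : ℂ) : FactorsAt m x (C c * Q) := by
  intro z u v
  simp only [slice_C_mul, Polynomial.eval_mul, Polynomial.eval_C]
  linear_combination c * h z u v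

theorem otherProd_pow (m n : ℕ) (x : Quotient r) (z : Quotient r → ℂ) (u : ℂ) :
    otherProd m x z u ^ n = otherProd (m * n) x z u := by
  rw [otherProd, otherProd, ← Finset.prod_pow]
  refine Finset.prod_congr rfl fun i _ => ?_
  split_ifs <;> simp [pow_mul]

theorem FactorsAt.pow {m : ℕ} {x : Quotient r} {Q : MvPolynomial (Quotient r) ℂ}
    (h : FactorsAt m x Q) (n : ℕ) : FactorsAt (m * n) x (Q ^ n) := by
  intro z u v
  simp only [slice_pow, Polynomial.eval_pow, ← otherProd_pow, ← mul_pow, h z u v]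

/-- A particle left alone by the fusion has zero displacement, so the identity defining `FactorsAt`
holds along the whole expansion. Its coefficient at `lam ^ d` involves only the constant term of the
product, since the expansion of `Q` starts there. -/
theorem FactorsAt.step {s : Setoid (Fin N)} {h : r ≤ s} {m d : ℕ} {x : Quotient r}
    {Q : MvPolynomial (Quotient r) ℂ} {Q' : MvPolynomial (Quotient s) ℂ} (hQ : FactorsAt m x Q)
    (hx : ∀ y, fuseMap h y = fuseMap h x → y = x) (hstep : IsStepOfOrder h Q Q' d) :
    FactorsAt m (fuseMap h x) Q' := by
  classical
  intro z u v
  obtain ⟨ξ, c, hξ, hc, hcoeff⟩ := hstep.exists_centered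
  have hξx := hξ.eq_zero_of_fiber h hx
  have hmk : ∀ i : Fin N, Quotient.mk s i = fuseMap h x ↔ Quotient.mk r i = x := fun i =>
    ⟨fun h1 => hx _ h1, fun h1 => by rw [← h1]; rfl⟩
  let B : ℂ → Polynomial ℂ := fun u => ∏ i : Fin N, if Quotient.mk r i = x then 1 else
    (Polynomial.C u - (Polynomial.C (z (Quotient.mk s i)) +
      Polynomial.X * Polynomial.C (ξ (Quotient.mk r i)))) ^ m
  have hB : ∀ u t, (B u).eval t = otherProd m x (fun y => z (fuseMap h y) + t * ξ y) u := by
    intro u t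
    rw [otherProd, Polynomial.eval_prod]
    refine Finset.prod_congr rfl fun i _ => ?_
    by_cases hi : Quotient.mk r i = x
    · simp [hi]
    · simp only [hi, if_false, Polynomial.eval_pow, Polynomial.eval_sub, Polynomial.eval_C,
        Polynomial.eval_add, Polynomial.eval_mul, Polynomial.eval_X]
      rfl
  have hB0 : ∀ u, (B u).coeff 0 = otherProd m (fuseMap h x) z u := by
    intro u
    rw [Polynomial.coeff_zero_eq_eval_zero, hB, otherProd, otherProd]
    refine Finset.prod_congr rfl fun i _ => ?_
    by_cases hi : Quotient.mk r i = x
    · rw [if_pos hi, if_pos ((hmk i).2 hi)]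
    · rw [if_neg hi, if_neg fun h1 => hi ((hmk i).1 h1), zero_mul, add_zero]
      rfl
  have hE : ∀ u t, (fusionExpansion h Q (Function.update z (fuseMap h x) u) ξ).eval t =
      (slice Q x fun y => z (fuseMap h y) + t * ξ y).eval u := by
    intro u t
    rw [eval_fusionExpansion, eval_slice]
    congr 2
    funext y
    by_cases hy : y = x
    · subst hy; simp [hξx]
    · rw [Function.update_of_ne hy, Function.update_of_ne fun h1 => hy (hx y h1)]
  have key : fusionExpansion h Q (Function.update z (fuseMap h x) u) ξ * B v =
      fusionExpansion h Q (Function.update z (fuseMap h x) v) ξ * B u := by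
    apply Polynomial.funext
    intro t
    simp only [Polynomial.eval_mul, hB, hE]
    exact hQ _ u v
  have h1 := congrArg (fun p => Polynomial.coeff p d) key
  simp only [coeff_mul_of_coeff_lt_eq_zero (hcoeff _).1, hB0, (hcoeff _).2] at h1
  apply mul_left_cancel₀ hc
  rw [eval_slice, eval_slice]
  linear_combination h1

open Classical in
theorem sum_ite_mk_eq_natCast (y : Quotient r) (m : ℕ) :
    ∑ i : Fin N, (if Quotient.mk r i = y then (m : ℕ∞) else 0) = (m * particleType y : ℕ) := by
  rw [particleType_eq_card, ← Finset.sum_filter, Finset.sum_const, nsmul_eq_mul]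
  push_cast
  rw [mul_comm]

/-- Up to nonzero factors free of `x`, which `X x - X y` cannot divide, `Q` is the product of the
`(X x - X y') ^ m` over the original particles outside `x`. Those lying in `y` contribute `m` each.
-/
theorem FactorsAt.emultiplicity_eq {m : ℕ} {x y : Quotient r} {Q : MvPolynomial (Quotient r) ℂ}
    (h : FactorsAt m x Q) (hQ : Q ≠ 0) (hxy : x ≠ y) :
    emultiplicity (X x - X y) Q = (m * particleType y : ℕ) := by
  classical
  obtain ⟨v, hv⟩ := exists_substVar_ne_zero hQ x
  let B : MvPolynomial (Quotient r) ℂ :=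
    ∏ i : Fin N, if Quotient.mk r i = x then 1 else (X x - X (Quotient.mk r i)) ^ m
  have key : Q * otherPoly m x v = substVar Q x v * B := by
    apply MvPolynomial.funext
    intro z
    have hB : eval z B = otherProd m x z (z x) := by
      rw [map_prod, otherProd]
      refine Finset.prod_congr rfl fun i _ => ?_
      by_cases hi : Quotient.mk r i = x <;> simp [hi]
    rw [map_mul, map_mul, eval_otherPoly, eval_substVar, hB, ← h z (z x) v, eval_slice_self]
  have hp := prime_X_sub_X hxy
  have h1 := congrArg (emultiplicity (X x - X y)) key
  rw [emultiplicity_mul hp, emultiplicity_mul hp,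
    emultiplicity_X_sub_X_of_notMem_vars (notMem_vars_otherPoly m x v) (otherPoly_ne_zero m x v),
    emultiplicity_X_sub_X_of_notMem_vars (notMem_vars_substVar Q x v) hv, add_zero, zero_add,
    Finset.emultiplicity_prod hp] at h1
  rw [h1, ← sum_ite_mk_eq_natCast]
  refine Finset.sum_congr rfl fun i _ => ?_
  by_cases hi : Quotient.mk r i = y
  · rw [if_pos hi, if_neg (by rw [hi]; exact hxy.symm), hi, emultiplicity_pow_self_of_prime hp]
  · rw [if_neg hi]
    by_cases hx : Quotient.mk r i = x
    · rw [if_pos hx, emultiplicity_eq_zero]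
      exact fun h2 => hp.not_isUnit (isUnit_of_dvd_one h2)
    · rw [if_neg hx, emultiplicity_eq_zero]
      intro h2
      have h3 := X_sub_X_dvd_iff.1 (hp.dvd_of_dvd_pow h2)
      rw [map_sub, rename_X, rename_X, Function.update_self, Function.update_of_ne hx] at h3
      exact X_sub_X_ne_zero (Ne.symm hi) h3

/-! ### Independence of a particle -/

/-- Equal dependence on `x` cancels in the quotient, which therefore equals its value at any `v`
where the denominator does not vanish. -/
theorem FactorsAt.isIndependentOf {M : ℕ} {x : Quotient r} {Q F : MvPolynomial (Quotient r) ℂ}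
    (hQ : FactorsAt M x Q) (hF : FactorsAt M x F) (hF0 : F ≠ 0) :
    IsIndependentOf ((algebraMap _ (FractionRing (MvPolynomial (Quotient r) ℂ)) Q) /
      algebraMap _ _ F) x := by
  obtain ⟨v, hv⟩ := exists_substVar_ne_zero hF0 x
  refine ⟨substVar Q x v, substVar F x v, notMem_vars_substVar _ _ _,
    notMem_vars_substVar _ _ _, hv, ?_⟩
  have hinj := IsFractionRing.injective (MvPolynomial (Quotient r) ℂ)
    (FractionRing (MvPolynomial (Quotient r) ℂ))
  rw [div_eq_div_iff ((map_ne_zero_iff _ hinj).2 hF0) ((map_ne_zero_iff _ hinj).2 hv),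
    ← map_mul, ← map_mul]
  congr 1
  have hne : ∀ u : ℂ, otherPoly M x u ≠ 0 := otherPoly_ne_zero M x
  apply MvPolynomial.funext
  intro w
  have key : substVar Q x (w x) * substVar F x v = substVar Q x v * substVar F x (w x) := by
    refine eq_of_eval_eq_of_eval_ne_zero (mul_ne_zero (hne (w x)) (hne v)) fun z hz => ?_
    rw [map_mul, eval_otherPoly, eval_otherPoly] at hz
    simp only [map_mul, eval_substVar]
    apply mul_right_cancel₀ hz
    linear_combination (slice F x z).eval v * otherProd M x z (w x) * hQ z (w x) v -
      (slice Q x z).eval v * otherProd M x z (w x) * hF z (w x) v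
  simpa only [map_mul, eval_substVar, eval_slice_self] using congrArg (eval w) key

theorem FactorsAt.of_isIndependentOf {M : ℕ} {x : Quotient r} {Q F : MvPolynomial (Quotient r) ℂ}
    (hF : FactorsAt M x F) (hF0 : F ≠ 0)
    (h : IsIndependentOf ((algebraMap _ (FractionRing (MvPolynomial (Quotient r) ℂ)) Q) /
      algebraMap _ _ F) x) : FactorsAt M x Q := by
  obtain ⟨A, B, hA, hB, hB0, hAB⟩ := h
  have hinj := IsFractionRing.injective (MvPolynomial (Quotient r) ℂ)
    (FractionRing (MvPolynomial (Quotient r) ℂ))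
  rw [div_eq_div_iff ((map_ne_zero_iff _ hinj).2 hF0) ((map_ne_zero_iff _ hinj).2 hB0),
    ← map_mul, ← map_mul] at hAB
  have hAB := hinj hAB
  refine FactorsAt.of_generic hB0 fun z hz u v => ?_
  have h1 : ∀ u, (slice Q x z).eval u * eval z B = eval z A * (slice F x z).eval u := by
    intro u
    have h2 := congrArg (fun p => (slice p x z).eval u) hAB
    simpa only [slice_mul, Polynomial.eval_mul, eval_slice_of_notMem_vars hA,
      eval_slice_of_notMem_vars hB] using h2
  apply mul_right_cancel₀ hz
  linear_combination otherProd M x z v * h1 u - otherProd M x z u * h1 v + eval z A * hF z u v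

end FactorsAt

/-! ### The cluster of a polynomial of low degree -/

section LowDegree

variable {N : ℕ} {A : Finset (Fin N)}

/-- At distinct positions the linear factors are pairwise coprime, so the separate divisibilities
combine. -/
theorem prod_dvd_slice {a : Fin N} (ha : a ∈ A)
    {Q : MvPolynomial (Quotient (twoBlock A ∅)) ℂ} {D : ℕ}
    (hD : ∀ i ∉ A, (X (Quotient.mk _ a) - X (Quotient.mk _ i)) ^ D ∣ Q)
    {z : Quotient (twoBlock A ∅) → ℂ}
    (hz : ∀ i ∉ A, ∀ j ∉ A, i ≠ j → z (Quotient.mk _ i) ≠ z (Quotient.mk _ j)) :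
    ∏ i ∈ Aᶜ, (Polynomial.X - Polynomial.C (z (Quotient.mk _ i))) ^ D ∣
      slice Q (Quotient.mk _ a) z := by
  classical
  apply Finset.prod_dvd_of_coprime
  · intro i hi j hj hij
    apply IsCoprime.pow
    exact Polynomial.isCoprime_X_sub_C_of_isUnit_sub
      (sub_ne_zero.2 (hz i (by simpa using hi) j (by simpa using hj) hij)).isUnit
  · intro i hi
    have hi : i ∉ A := by simpa using hi
    obtain ⟨G, rfl⟩ := hD i hi
    have hne : Quotient.mk (twoBlock A ∅) i ≠ Quotient.mk _ a := by
      rw [Ne, mk_block_eq_iff]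
      rintro (rfl | h)
      · exact hi ha
      · exact hi h.1
    rw [slice_mul, slice_pow]
    refine Dvd.intro _ (congrArg (· * _) ?_)
    simp [slice, hne]

theorem exists_generic_ne_zero (A : Finset (Fin N)) :
    ∃ D : MvPolynomial (Quotient (twoBlock A ∅)) ℂ, D ≠ 0 ∧ ∀ z, eval z D ≠ 0 →
      ∀ i ∉ A, ∀ j ∉ A, i ≠ j → z (Quotient.mk _ i) ≠ z (Quotient.mk _ j) := by
  classical
  refine ⟨∏ i, ∏ j, if Quotient.mk (twoBlock A ∅) i = Quotient.mk _ j then 1 else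
    (X (Quotient.mk _ i) - X (Quotient.mk _ j)), ?_, ?_⟩
  · simp only [Finset.prod_ne_zero_iff]
    intro i _ j _
    split_ifs with hij
    · exact one_ne_zero
    · exact X_sub_X_ne_zero hij
  · intro z hz i hi j hj hij h0
    apply hz
    rw [map_prod]
    apply Finset.prod_eq_zero (Finset.mem_univ i)
    rw [map_prod]
    apply Finset.prod_eq_zero (Finset.mem_univ j)
    rw [if_neg, map_sub, eval_X, eval_X, h0, sub_self]
    rw [mk_block_eq_iff]
    rintro (h | h)
    · exact hij h
    · exact hi h.1

theorem natDegree_prod_compl (A : Finset (Fin N)) (w : Fin N → ℂ) (D : ℕ) :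
    (∏ i ∈ Aᶜ, (Polynomial.X - Polynomial.C (w i)) ^ D).natDegree = D * (N - A.card) := by
  rw [Polynomial.natDegree_prod_of_monic _ _ fun i _ => (Polynomial.monic_X_sub_C _).pow D]
  simp [Finset.card_compl, mul_comm]

theorem mul_le_of_natDegree_slice_le {a : Fin N} (ha : a ∈ A)
    {Q : MvPolynomial (Quotient (twoBlock A ∅)) ℂ} (hQ : Q ≠ 0) {D K : ℕ}
    (hD : ∀ i ∉ A, (X (Quotient.mk _ a) - X (Quotient.mk _ i)) ^ D ∣ Q)
    (hK : ∀ z, (slice Q (Quotient.mk _ a) z).natDegree ≤ K) : D * (N - A.card) ≤ K := by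
  obtain ⟨G, hG, hgen⟩ := exists_generic_ne_zero A
  obtain ⟨z, hz⟩ := exists_eval_ne_zero (mul_ne_zero hQ hG)
  rw [map_mul] at hz
  have h1 := prod_dvd_slice ha hD (hgen z (right_ne_zero_of_mul hz))
  have h2 : slice Q (Quotient.mk _ a) z ≠ 0 := by
    intro h0
    apply left_ne_zero_of_mul hz
    rw [← eval_slice_self Q (Quotient.mk _ a), h0, Polynomial.eval_zero]
  have h3 := Polynomial.natDegree_le_of_dvd h1 h2
  rw [natDegree_prod_compl] at h3
  exact h3.trans (hK z)

/-- The degree bound equals the degree of the forced divisor, so the cofactor is a constant in the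
cluster variable. -/
theorem factorsAt_of_natDegree_slice_le {a : Fin N} (ha : a ∈ A)
    {Q : MvPolynomial (Quotient (twoBlock A ∅)) ℂ} {D : ℕ}
    (hD : ∀ i ∉ A, (X (Quotient.mk _ a) - X (Quotient.mk _ i)) ^ D ∣ Q)
    (hK : ∀ z, (slice Q (Quotient.mk _ a) z).natDegree ≤ D * (N - A.card)) :
    FactorsAt D (Quotient.mk _ a) Q := by
  classical
  obtain ⟨G, hG, hgen⟩ := exists_generic_ne_zero A
  refine FactorsAt.of_generic hG fun z hz u v => ?_
  have h1 := prod_dvd_slice ha hD (hgen z hz)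
  have hdeg := hK z
  set B := ∏ i ∈ Aᶜ, (Polynomial.X - Polynomial.C (z (Quotient.mk _ i))) ^ D with hB
  have hBev : ∀ u, B.eval u = otherProd D (Quotient.mk _ a) z u := by
    intro u
    rw [hB, Polynomial.eval_prod, otherProd]
    have : ∀ i : Fin N, (Quotient.mk (twoBlock A ∅) i = Quotient.mk _ a) ↔ i ∈ A := by
      intro i
      rw [mk_block_eq_iff]
      constructor
      · rintro (rfl | h)
        · exact ha
        · exact h.1
      · exact fun h => Or.inr ⟨h, ha⟩
    rw [← Finset.prod_subset (Finset.subset_univ Aᶜ)]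
    · refine Finset.prod_congr rfl fun i hi => ?_
      rw [if_neg fun h => (Finset.mem_compl.1 hi) ((this i).1 h)]
      simp
    · intro i _ hi
      rw [if_pos ((this i).2 (by simpa using hi))]
  obtain ⟨q, hq⟩ := h1
  have hq0 : ∃ c, q = Polynomial.C c := by
    by_cases h0 : q = 0
    · exact ⟨0, by simp [h0]⟩
    have hBm : B.Monic := Polynomial.monic_prod_of_monic _ _ fun i _ =>
      (Polynomial.monic_X_sub_C _).pow D
    rw [hq, Polynomial.natDegree_mul hBm.ne_zero h0, natDegree_prod_compl] at hdeg
    exact ⟨_, Polynomial.eq_C_of_natDegree_eq_zero (by omega)⟩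
  obtain ⟨c, rfl⟩ := hq0
  rw [hq]
  simp only [Polynomial.eval_mul, hBev, Polynomial.eval_C]
  ring

end LowDegree

/-! ### The Laughlin state -/

section Laughlin

variable {N : ℕ}

open Classical in
/-- The polynomial derived from the Laughlin state in the configuration `r`. -/
noncomputable def laughlinDerived (r : Setoid (Fin N)) (m : ℕ) : MvPolynomial (Quotient r) ℂ :=
  ∏ i : Fin N, ∏ j ∈ Finset.Ioi i, (if Quotient.mk r i = Quotient.mk r j then 1 else
    X (Quotient.mk r i) - X (Quotient.mk r j)) ^ m

theorem laughlinDerived_ne_zero (r : Setoid (Fin N)) (m : ℕ) : laughlinDerived r m ≠ 0 := by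
  simp only [laughlinDerived, Finset.prod_ne_zero_iff]
  intro i _ j _
  apply pow_ne_zero
  split_ifs with hij
  · exact one_ne_zero
  · exact X_sub_X_ne_zero hij

/-- Derived steps are multiplicative, so each difference is fused separately: it has order one if
its two particles merge in this step and order zero otherwise. -/
theorem isDerivedStep_laughlinDerived {r s : Setoid (Fin N)} (h : r ≤ s) (m : ℕ) :
    IsDerivedStep h (laughlinDerived r m) (laughlinDerived s m) := by
  classical
  refine IsDerivedStep.prod _ fun i _ => IsDerivedStep.prod _ fun j _ => ?_
  have key : ∃ d, IsStepOfOrder h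
      (if Quotient.mk r i = Quotient.mk r j then 1 else X (Quotient.mk r i) - X (Quotient.mk r j))
      (if Quotient.mk s i = Quotient.mk s j then 1 else X (Quotient.mk s i) - X (Quotient.mk s j))
      d := by
    by_cases hr : Quotient.mk r i = Quotient.mk r j
    · have hs : Quotient.mk s i = Quotient.mk s j := congrArg (fuseMap h) hr
      rw [if_pos hr, if_pos hs]
      exact ⟨0, isStepOfOrder_one⟩
    · rw [if_neg hr]
      by_cases hs : Quotient.mk s i = Quotient.mk s j
      · rw [if_pos hs]
        exact ⟨1, isStepOfOrder_X_sub_X h hr hs⟩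
      · rw [if_neg hs]
        have hren : rename (fuseMap h) (X (Quotient.mk r i) - X (Quotient.mk r j)) =
            (X (Quotient.mk s i) - X (Quotient.mk s j) : MvPolynomial _ ℂ) := by
          rw [map_sub, rename_X, rename_X]
          rfl
        have := isStepOfOrder_rename (h := h) (Q := X (Quotient.mk r i) - X (Quotient.mk r j))
          (by rw [hren]; exact X_sub_X_ne_zero hs)
        rw [hren] at this
        exact ⟨0, this⟩
  obtain ⟨d, hd⟩ := key
  exact isDerivedStep_iff.2 ⟨_, hd.pow m⟩

theorem laughlinDerived_bot (m : ℕ) :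
    laughlinDerived (⊥ : Setoid (Fin N)) m = rename (Quotient.mk ⊥) (laughlin N m) := by
  simp only [laughlinDerived, laughlin, map_prod]
  refine Finset.prod_congr rfl fun i _ => Finset.prod_congr rfl fun j hj => ?_
  have : Quotient.mk (⊥ : Setoid (Fin N)) i ≠ Quotient.mk ⊥ j := by
    intro h
    have : i = j := Quotient.exact h
    exact (Finset.mem_Ioi.1 hj).ne this
  rw [if_neg this]
  simp

theorem isDerived_laughlinDerived (m : ℕ) {r : Setoid (Fin N)} (p : FusionProcess N r) :
    p.IsDerived (laughlin N m) (laughlinDerived r m) := by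
  induction p with
  | start => exact laughlinDerived_bot m
  | fuse p s h ih => exact ⟨_, ih, isDerivedStep_laughlinDerived h m⟩

theorem eq_C_mul_laughlinDerived (m : ℕ) {r : Setoid (Fin N)} (p : FusionProcess N r)
    {F : MvPolynomial (Quotient r) ℂ} (hF : p.IsDerived (laughlin N m) F) :
    ∃ c : ℂ, c ≠ 0 ∧ F = C c * laughlinDerived r m := by
  induction p with
  | start => exact ⟨1, one_ne_zero, by
      rw [map_one, one_mul, laughlinDerived_bot]
      exact hF⟩
  | fuse p s h ih =>
    obtain ⟨F₀, hF₀, hstep⟩ := hF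
    obtain ⟨c, hc, rfl⟩ := ih hF₀
    obtain ⟨d, hd⟩ := isDerivedStep_iff.1 (isDerivedStep_laughlinDerived h m)
    exact IsDerivedStep.unique (isDerivedStep_iff.2 ⟨d, hd.C_mul hc⟩) hstep

theorem factorsAt_laughlinDerived (m : ℕ) {r : Setoid (Fin N)} (x : Quotient r) :
    FactorsAt (m * particleType x) x (laughlinDerived r m) := by
  classical
  intro z u v
  let g : ℂ → Fin N → Fin N → ℂ := fun u i j => (if Quotient.mk r i = Quotient.mk r j then 1 else
    Function.update z x u (Quotient.mk r i) - Function.update z x u (Quotient.mk r j)) ^ m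
  let k : ℂ → Fin N → Fin N → ℂ := fun u i j => if Quotient.mk r i = x then
    (if Quotient.mk r j = x then 1 else (u - z (Quotient.mk r j)) ^ m) else 1
  have hg : ∀ u, (slice (laughlinDerived r m) x z).eval u =
      ∏ i, ∏ j ∈ Finset.Ioi i, g u i j := by
    intro u
    rw [eval_slice, laughlinDerived, map_prod]
    refine Finset.prod_congr rfl fun i _ => ?_
    rw [map_prod]
    refine Finset.prod_congr rfl fun j _ => ?_
    rw [map_pow]
    simp only [g]
    congr 1
    split_ifs <;> simp
  have hk : ∀ u, otherProd (m * particleType x) x z u =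
      ∏ i, ∏ j ∈ Finset.Ioi i, (k u i j * k u j i) := by
    intro u
    -- A product over ordered pairs of original particles is regrouped over `i < j` to match the
    -- Laughlin product. The signs that arise when `x` contains the larger index do not depend on
    -- `u`.
    refine Eq.trans ?_
      (Finset.prod_prod_Ioi_mul_eq_prod_prod_off_diag fun i j => k u j i).symm
    rw [← otherProd_pow, particleType_eq_card,
      ← Finset.prod_const, Finset.prod_filter]
    refine Finset.prod_congr rfl fun i _ => ?_
    by_cases hi : Quotient.mk r i = x
    · rw [if_pos hi, otherProd, ← Finset.prod_compl_mul_prod {i}, Finset.prod_singleton, if_pos hi,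
        mul_one]
      refine Finset.prod_congr rfl fun j _ => ?_
      simp [k, hi]
    · simp [k, hi]
  rw [hg, hg, hk, hk]
  simp only [← Finset.prod_mul_distrib]
  refine Finset.prod_congr rfl fun i _ => Finset.prod_congr rfl fun j _ => ?_
  simp only [g, k]
  by_cases hij : Quotient.mk r i = Quotient.mk r j
  · by_cases hj : Quotient.mk r j = x <;> simp [hij, hj]
  · by_cases hi : Quotient.mk r i = x
    · have hj : Quotient.mk r j ≠ x := fun h => hij (hi.trans h.symm)
      have hxj : ¬ x = Quotient.mk r j := fun h => hj h.symm
      simp [hi, hj, hxj]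
      ring
    · by_cases hj : Quotient.mk r j = x
      · simp only [hi, hj, if_true, if_false, Function.update_self, Function.update_of_ne hi,
          one_mul, ← mul_pow]
        congr 1
        ring
      · simp [hi, hj, hij]

end Laughlin

/-! ### Local orders and cluster form -/

section ClusterForm

variable {N : ℕ} {P : MvPolynomial (Fin N) ℂ}

/-- Two such particles do not fit into `N` variables, so the condition is vacuous. -/
theorem hasLocalOrder_of_lt (P : MvPolynomial (Fin N) ℂ) {a b : ℕ} (hab : N < a + b) (d : ℕ) :
    HasLocalOrder P a b d := by
  classical
  intro r p Q _ x y hxy hx hy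
  exfalso
  rw [particleType_eq_card] at hx hy
  have hdisj : Disjoint (Finset.univ.filter fun i : Fin N => Quotient.mk r i = x)
      (Finset.univ.filter fun i : Fin N => Quotient.mk r i = y) := by
    rw [Finset.disjoint_filter]
    intro i _ h1 h2
    exact hxy (h1.symm.trans h2)
  have h1 := Finset.card_le_univ (Finset.disjUnion _ _ hdisj)
  rw [Finset.card_disjUnion, hx, hy, Fintype.card_fin] at h1
  omega

/-- The Laughlin factor at an `n`-type particle is inherited by `Q ^ n`. Comparing the order at a
`b`-type particle gives `n * D = m * n * b`. -/
theorem HasClusterForm.localOrder_eq (hP : IsAdmissible P) {n m b D : ℕ}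
    (hcf : HasClusterForm n m P) (hn : 0 < n) (hb : 0 < b) (hN : n + b ≤ N)
    (hD : HasLocalOrder P n b D) : D = m * b := by
  classical
  obtain ⟨A, B, hAB, hA, hB⟩ := exists_disjoint_card_eq hN
  obtain ⟨a, ha⟩ : A.Nonempty := Finset.card_pos.1 (by omega)
  obtain ⟨j, hj⟩ : B.Nonempty := Finset.card_pos.1 (by omega)
  let p : FusionProcess N (twoBlock A B) := .fuse .start (twoBlock A B) bot_le
  obtain ⟨Q, hQ⟩ := hP.ufc.1 _ p
  have hx : particleType (Quotient.mk (twoBlock A B) a) = n :=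
    (particleType_twoBlock_left hAB ha).trans hA
  have hy : particleType (Quotient.mk (twoBlock A B) j) = b :=
    (particleType_twoBlock_right hAB hj).trans hB
  have hxy : Quotient.mk (twoBlock A B) a ≠ Quotient.mk _ j := by
    have := Finset.disjoint_left.1 hAB ha
    have := Finset.disjoint_right.1 hAB hj
    rw [Ne, mk_twoBlock_eq_iff' hAB]
    grind
  have h1 := hcf _ p Q _ hQ (isDerived_laughlinDerived m p) _ hx
  rw [← map_pow] at h1
  have h2 := factorsAt_laughlinDerived m (Quotient.mk (twoBlock A B) a)
  rw [hx] at h2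
  have h3 := FactorsAt.of_isIndependentOf h2 (laughlinDerived_ne_zero _ m) h1
  have h4 := h3.emultiplicity_eq (pow_ne_zero n (hQ.ne_zero hP.ufc.ne_zero)) hxy
  rw [emultiplicity_pow (prime_X_sub_X hxy), hD _ p Q hQ _ _ hxy hx hy, hy] at h4
  have h5 : n * D = m * n * b := by exact_mod_cast h4
  exact Nat.eq_of_mul_eq_mul_left hn (by rw [h5]; ring)

theorem HasClusterForm.S_add (hP : IsAdmissible P) {n m b : ℕ} (hcf : HasClusterForm n m P)
    (hn : 0 < n) (hN : n + b ≤ N) : S P (n + b) = S P n + S P b + m * b := by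
  rcases Nat.eq_zero_or_pos b with rfl | hb
  · simp [S_zero hP.ufc.ne_zero]
  · obtain ⟨D, hD⟩ := hP.ulc n b
    rw [← hcf.localOrder_eq hP hn hb hN hD]
    exact PatternOfZeros.S_add hP hn hb hN hD

/-- The clusters of size `n` are added one by one; the costs `m * (i * n + b)` for `i < j` sum to a
triangular number, and doubling clears its denominator. -/
theorem HasClusterForm.S_mul_add (hP : IsAdmissible P) {n m : ℕ} (hcf : HasClusterForm n m P)
    (hn : 0 < n) (b j : ℕ) (hN : j * n + b ≤ N) :
    2 * (S P (j * n + b) : ℚ) =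
      2 * S P b + 2 * j * S P n + m * (2 * b * j + n * j * (j - 1)) := by
  induction j with
  | zero => simp
  | succ j ih =>
    have hle : j * n + b ≤ N := by
      rw [Nat.succ_mul] at hN
      omega
    have hadd : (j + 1) * n + b = n + (j * n + b) := by ring
    rw [hadd, hcf.S_add hP hn (hadd ▸ hN)]
    have := ih hle
    push_cast
    linear_combination this

theorem dvd_of_hasLocalOrder {A : Finset (Fin N)} {a : Fin N} (ha : a ∈ A) {D : ℕ}
    (hD : HasLocalOrder P A.card 1 D) {p : FusionProcess N (twoBlock A ∅)}
    {Q : MvPolynomial (Quotient (twoBlock A ∅)) ℂ} (hQ : p.IsDerived P Q) :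
    ∀ i ∉ A, (X (Quotient.mk _ a) - X (Quotient.mk _ i)) ^ D ∣ Q := by
  intro i hi
  apply pow_dvd_of_le_emultiplicity
  refine (hD _ p Q hQ _ _ ?_ (particleType_twoBlock_left (by simp) ha)
    (particleType_twoBlock_other (by simp) hi (by simp))).ge
  rw [Ne, mk_block_eq_iff]
  rintro (rfl | h)
  · exact hi ha
  · exact hi h.2

/-- The forced divisor has degree `D * (N - a)` in the cluster variable, while `a` variables supply
degree at most `a * maxDegree P`. -/
theorem IsAdmissible.localOrder_mul_le (hP : IsAdmissible P) {a D : ℕ} (ha : 0 < a) (haN : a ≤ N)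
    (hD : HasLocalOrder P a 1 D) : D * (N - a) ≤ a * maxDegree P := by
  obtain ⟨A, rfl⟩ := exists_card_eq haN
  obtain ⟨i, hi⟩ := Finset.card_pos.1 ha
  obtain ⟨Q, hQ, hstep⟩ := exists_step_block hP ⟨i, hi⟩
  refine mul_le_of_natDegree_slice_le hi hstep.ne_zero (dvd_of_hasLocalOrder hi hD hQ) fun z =>
    (natDegree_slice_le hi hstep (M := A.card * maxDegree P) ?_ z).trans (Nat.sub_le _ _)
  intro m hm
  exact (Finset.sum_le_sum fun j _ => le_maxDegree hm j).trans (by simp)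

theorem IsAMS.factorsAt (hP : IsAMS P) {n m : ℕ} (hm : HasLocalOrder P n 1 m)
    (hJ : J P n = 1 / 2 * (m : ℚ) * ((N : ℚ) - (n : ℚ))) {r : Setoid (Fin N)}
    (p : FusionProcess N r) {Q : MvPolynomial (Quotient r) ℂ} (hQ : p.IsDerived P Q)
    {x : Quotient r} (hx : particleType x = n) : FactorsAt m x Q := by
  classical
  set A : Finset (Fin N) := Finset.univ.filter fun i => Quotient.mk r i = x with hA
  have hcard : A.card = n := by rw [← hx, particleType_eq_card]
  have hmem : ∀ i, i ∈ A ↔ Quotient.mk r i = x := fun i => by simp [hA]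
  obtain ⟨a, hax⟩ := Quotient.exists_rep x
  have ha : a ∈ A := (hmem a).2 hax
  have hnN : n ≤ N := by
    rw [← hcard]
    simpa using A.card_le_univ
  have hle : twoBlock A ∅ ≤ r := by
    rw [twoBlock_le_iff (by simp)]
    refine ⟨fun i hi j hj => Quotient.exact (((hmem i).1 hi).trans ((hmem j).1 hj).symm), by simp⟩
  obtain ⟨Q₁, hQ₁, hstep⟩ := exists_step_block hP.toIsAdmissible ⟨a, ha⟩
  -- The value of `J_n` says that the available degree `n * d - 2 * S_n` is exactly `m * (N - n)`.
  have hdeg : n * maxDegree P = 2 * S P n + m * (N - n) := by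
    rw [J] at hJ
    have : (n : ℚ) * maxDegree P = 2 * S P n + m * ((N : ℚ) - n) := by linarith
    rw [← Nat.cast_sub hnN] at this
    exact_mod_cast this
  have hfac₁ : FactorsAt m (Quotient.mk (twoBlock A ∅) a) Q₁ := by
    refine factorsAt_of_natDegree_slice_le ha (dvd_of_hasLocalOrder ha (hcard ▸ hm) hQ₁) fun z =>
      (natDegree_slice_le ha hstep (M := A.card * maxDegree P - S P A.card) ?_ z).trans ?_
    · intro m hm
      have := hP.sum_add_S_le A hm
      omega
    · rw [hcard]
      omega
  -- UFC replaces the given process by one that forms the cluster `A` first, where the factorization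
  -- is known.
  obtain ⟨Q₂, hQ₂⟩ := hP.ufc.1 r (.fuse (.fuse .start (twoBlock A ∅) bot_le) r hle)
  obtain ⟨c, -, rfl⟩ := hP.ufc.2 r _ p Q₂ Q hQ₂ hQ
  obtain ⟨Q₀, hQ₀, hstep₂⟩ := hQ₂
  obtain ⟨c₀, -, rfl⟩ := hP.ufc.2 _ _ _ Q₁ Q₀ hQ₁ hQ₀
  obtain ⟨d, hd⟩ := isDerivedStep_iff.1 hstep₂
  have hfac := (hfac₁.C_mul c₀).step (h := hle) ?_ hd
  · rw [← hax]
    exact hfac.C_mul c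
  · intro y
    induction y using Quotient.inductionOn with | _ j
    intro hj
    have hj : Quotient.mk r j = Quotient.mk r a := hj
    exact mk_block_eq_iff.2 (Or.inr ⟨(hmem j).2 (hj.trans hax), ha⟩)

theorem IsAMS.hasClusterForm (hP : IsAMS P) {n m : ℕ} (hm : HasLocalOrder P n 1 m)
    (hJ : J P n = 1 / 2 * (m : ℚ) * ((N : ℚ) - (n : ℚ))) : HasClusterForm n m P := by
  intro r p Q F hQ hF x hx
  obtain ⟨c, hc, rfl⟩ := eq_C_mul_laughlinDerived m p hF
  have h1 := (hP.factorsAt hm hJ p hQ hx).pow n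
  have h2 := (factorsAt_laughlinDerived m x).C_mul c
  rw [hx] at h2
  rw [← map_pow]
  exact h1.isIndependentOf h2 (mul_ne_zero (by simpa using hc) (laughlinDerived_ne_zero r m))

/-- With `N = n * (l + 1)`, the number `S_{N-a}` is computed twice: from `S_a` by inversion, and
from `S_{n-a}` by adding `l` clusters of size `n`. -/
theorem IsAMS.S_reflection (hP : IsAMS P) {n m : ℕ} (hn : 0 < n) (hN : 0 < N) (hdvd : n ∣ N)
    (hm : HasLocalOrder P n 1 m) (hJ : J P n = 1 / 2 * (m : ℚ) * ((N : ℚ) - (n : ℚ))) {a : ℕ}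
    (ha : a ≤ n) :
    (S P a : ℚ) = (S P (n - a) : ℚ) - ((n : ℚ) - 2 * (a : ℚ)) / (n : ℚ) * (S P n : ℚ) := by
  obtain ⟨l, rfl⟩ := hdvd
  obtain ⟨l, rfl⟩ : ∃ k, l = k + 1 := ⟨l - 1, by
    have := Nat.pos_of_mul_pos_left hN
    omega⟩
  obtain ⟨e, he⟩ := hP.homogeneous
  have hnN : n ≤ n * (l + 1) := Nat.le_mul_of_pos_right n (by omega)
  have h1 := hP.S_sub he (ha.trans hnN)
  have h2 := hP.two_mul_degree he
  have hsub : n * (l + 1) - a = l * n + (n - a) := by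
    rw [mul_add, mul_one, Nat.add_sub_assoc ha, mul_comm]
  have h3 := (hP.hasClusterForm hm hJ).S_mul_add hP.toIsAdmissible hn (n - a) l (by omega)
  rw [← hsub] at h3
  have h1' : (S P (n * (l + 1) - a) : ℚ) + a * maxDegree P = e + S P a := by exact_mod_cast h1
  have h2' : (2 : ℚ) * e = n * (l + 1) * maxDegree P := by exact_mod_cast h2
  rw [J] at hJ
  rw [Nat.cast_sub ha] at h3
  push_cast at hJ
  have hn' : (n : ℚ) ≠ 0 := by exact_mod_cast hn.ne'
  field_simp
  have hd : (n : ℚ) * maxDegree P = 2 * S P n + m * n * l := by linear_combination 2 * hJ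
  linear_combination (n : ℚ) * (h3 / 2 - h1' - h2' / 2) - ((n : ℚ) * (l + 1) - 2 * a) / 2 * hd

/-- `S_N` is computed by adding `k + 1` clusters of size `n` to nothing. Dividing `J_N = 0` by `k +
1` leaves the required value of `J_n`. -/
theorem HasClusterForm.isNAMS (hP : IsAMS P) {n m k : ℕ} (hcf : HasClusterForm n m P) (hn : 0 < n)
    (hN : N = (k + 1) * n) : IsNAMS n P ∧ HasLocalOrder P n 1 m := by
  have hm : HasLocalOrder P n 1 m := by
    by_cases hlt : N < n + 1
    · exact hasLocalOrder_of_lt P hlt m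
    · obtain ⟨D, hD⟩ := hP.ulc n 1
      have := hcf.localOrder_eq hP.toIsAdmissible hn one_pos (by omega) hD
      rw [mul_one] at this
      exact this ▸ hD
  refine ⟨⟨hP, ?_, ⟨k + 1, by rw [hN, mul_comm]⟩, m, hm, ?_⟩, hm⟩
  · rw [hN]
    positivity
  · have h1 := hcf.S_mul_add hP.toIsAdmissible hn 0 (k + 1) (by omega)
    rw [add_zero, ← hN, S_zero hP.ufc.ne_zero] at h1
    have h2 := hP.J_eq_zero
    rw [J] at h2 ⊢
    have hN' : (N : ℚ) = (k + 1) * n := by exact_mod_cast hN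
    push_cast at h1
    rw [hN'] at h2 ⊢
    have hk : ((k : ℚ) + 1) ≠ 0 := by positivity
    apply mul_left_cancel₀ hk
    linear_combination h2 + h1 / 2

end ClusterForm

/-! ### Sequences -/

section Sequences

variable {n : ℕ} {N : ℕ → ℕ} {P : ∀ k, MvPolynomial (Fin (N k)) ℂ}

theorem IsNAMSSequence.n_pos (h : IsNAMSSequence n N P) : 0 < n :=
  Nat.pos_of_dvd_of_pos (h.nams 0).dvd (h.nams 0).pos

theorem IsNAMSSequence.le (h : IsNAMSSequence n N P) (k : ℕ) : n ≤ N k :=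
  Nat.le_of_dvd (h.nams k).pos (h.nams k).dvd

/-- `D_{n,1} = S_{n+1} - S_n` is part of the pattern of zeros. A member with `N k = n` imposes no
condition on it. -/
theorem IsNAMSSequence.exists_localOrder (h : IsNAMSSequence n N P) : ∃ m : ℕ, ∀ k,
    HasLocalOrder (P k) n 1 m ∧
      J (P k) n = 1 / 2 * (m : ℚ) * ((N k : ℚ) - (n : ℚ)) := by
  have hn := h.n_pos
  obtain ⟨k₀, hk₀⟩ := (h.tendsto.eventually_ge_atTop (n + 1)).exists
  obtain ⟨m, hm, -⟩ := (h.nams k₀).J_eq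
  refine ⟨m, fun k => ?_⟩
  obtain ⟨d, hd, hJ⟩ := (h.nams k).J_eq
  rcases (h.le k).eq_or_lt with heq | hlt
  · exact ⟨hasLocalOrder_of_lt _ (by omega) m, by rw [hJ, heq]; ring⟩
  · have h1 := S_succ (h.nams k₀).toIsAdmissible hn hk₀ hm
    have h2 := S_succ (h.nams k).toIsAdmissible hn hlt hd
    have h3 := h.pattern (n + 1) k₀ k hk₀ hlt
    have h4 := h.pattern n k₀ k (h.le k₀) (h.le k)
    obtain rfl : m = d := by omega
    exact ⟨hd, hJ⟩

/-- If `m = 0`, the degrees stay bounded while `N k` grows, so `localOrder_mul_le` forces every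
`D_{a,1}` to vanish, then every `S_a`, and finally the degrees. -/
theorem IsNAMSSequence.localOrder_pos (h : IsNAMSSequence n N P) {m : ℕ}
    (hm : ∀ k, J (P k) n = 1 / 2 * (m : ℚ) * ((N k : ℚ) - (n : ℚ))) : 0 < m := by
  have hn := h.n_pos
  rw [Nat.pos_iff_ne_zero]
  rintro rfl
  have hdeg : ∀ k, n * maxDegree (P k) = 2 * S (P 0) n := by
    intro k
    have h1 := hm k
    rw [J, h.pattern n k 0 (h.le k) (h.le 0)] at h1
    have : (n : ℚ) * maxDegree (P k) = 2 * S (P 0) n := by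
      push_cast at h1
      linarith
    exact_mod_cast this
  have hS : ∀ a k, a ≤ N k → S (P k) a = 0 := by
    intro a
    induction a with
    | zero => exact fun k _ => S_zero (h.nams k).ufc.ne_zero
    | succ a ih =>
      intro k hk
      rcases Nat.eq_zero_or_pos a with rfl | ha
      · exact S_one (h.nams k).toIsAdmissible (h.nams k).pos
      -- By the pattern, `S_{a+1}` may be computed in any member; this one is so large that `D * (N
      -- l - a) ≤ a * (2 * S_n)` leaves only `D = 0`.
      obtain ⟨l, hl⟩ :=
        (h.tendsto.eventually_ge_atTop (a + 1 + a * (2 * S (P 0) n))).exists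
      have haN : a + 1 ≤ N l := by omega
      obtain ⟨D, hD⟩ := (h.nams l).ulc a 1
      rw [h.pattern (a + 1) k l hk haN, S_succ (h.nams l).toIsAdmissible ha haN hD,
        ih l (by omega), zero_add]
      have h1 := (h.nams l).toIsAdmissible.localOrder_mul_le ha (by omega) hD
      have h2 : maxDegree (P l) ≤ 2 * S (P 0) n := by
        rw [← hdeg l]
        exact Nat.le_mul_of_pos_left _ hn
      have h3 := Nat.mul_le_mul_left a h2
      by_contra hD0
      have h4 : N l - a ≤ D * (N l - a) := Nat.le_mul_of_pos_left _ (Nat.pos_of_ne_zero hD0)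
      omega
  obtain ⟨k, hk⟩ := h.nonconstant
  have h1 := hdeg k
  rw [hS n 0 (h.le 0), mul_zero] at h1
  rcases Nat.mul_eq_zero.1 h1 with h2 | h2 <;> omega

theorem IsNAMSSequence.tendsto_filling (h : IsNAMSSequence n N P) {m : ℕ} (hm0 : 0 < m)
    (hm : ∀ k, J (P k) n = 1 / 2 * (m : ℚ) * ((N k : ℚ) - (n : ℚ))) :
    Tendsto (fun k => (N k : ℝ) / (maxDegree (P k) : ℝ)) atTop
      (𝓝 ((((n : ℚ) / (m : ℚ) : ℚ)) : ℝ)) := by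
  have hn : (n : ℝ) ≠ 0 := by exact_mod_cast h.n_pos.ne'
  have hm0' : (m : ℝ) ≠ 0 := by exact_mod_cast hm0.ne'
  have hdeg : ∀ k, (n : ℝ) * maxDegree (P k) = 2 * S (P 0) n + m * ((N k : ℝ) - n) := by
    intro k
    have h1 := hm k
    rw [J, h.pattern n k 0 (h.le k) (h.le 0)] at h1
    have h2 : (n : ℚ) * maxDegree (P k) = 2 * S (P 0) n + m * ((N k : ℚ) - n) := by linarith
    exact_mod_cast h2
  have hN : Tendsto (fun k => (N k : ℝ)) atTop atTop :=
    tendsto_natCast_atTop_atTop.comp h.tendsto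
  have h1 : Tendsto (fun k => (n : ℝ) / ((2 * S (P 0) n - m * n : ℝ) / N k + m)) atTop
      (𝓝 ((n : ℝ) / (0 + m))) :=
    tendsto_const_nhds.div ((hN.const_div_atTop _).add tendsto_const_nhds) (by simpa using hm0')
  rw [zero_add] at h1
  push_cast
  refine h1.congr fun k => ?_
  have hNk : (N k : ℝ) ≠ 0 := by exact_mod_cast (h.nams k).pos.ne'
  have h2 : (2 * S (P 0) n - m * n : ℝ) / N k + m = n * maxDegree (P k) / N k := by
    rw [hdeg k]
    field_simp
    ring
  rw [h2, div_div_eq_mul_div, mul_div_mul_left _ _ hn]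

end Sequences

end PatternOfZeros

/-! ### The theorem -/

open PatternOfZeros in
theorem theorem6p3 (n : ℕ) (N : ℕ → ℕ) (P : ∀ k, MvPolynomial (Fin (N k)) ℂ) :
    (IsNAMSSequence n N P →
      (∃ m : ℕ, 0 < m ∧ (∀ k, HasLocalOrder (P k) n 1 m) ∧
        IsNuSequence ((n : ℚ) / (m : ℚ)) N P ∧
        (∀ k, HasClusterForm n m (P k)) ∧
        ((∀ k, N k = (k + 1) * n) → IsNCFSequence n m N P)) ∧
      (∀ k a : ℕ, a ≤ n →
        (S (P k) a : ℚ) =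
          (S (P k) (n - a) : ℚ) - ((n : ℚ) - 2 * (a : ℚ)) / (n : ℚ) * (S (P k) n : ℚ))) ∧
    (∀ m : ℕ, IsNCFSequence n m N P → ∀ k, IsAMS (P k) →
      IsNAMS n (P k) ∧ HasLocalOrder (P k) n 1 m) := by
  refine ⟨fun h => ?_, fun m h k hk => ?_⟩
  · obtain ⟨m, hm⟩ := h.exists_localOrder
    have hm0 := h.localOrder_pos fun k => (hm k).2
    have hn := h.n_pos
    have hcf : ∀ k, HasClusterForm n m (P k) := fun k =>
      (h.nams k).hasClusterForm (hm k).1 (hm k).2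
    have hnu : IsNuSequence ((n : ℚ) / (m : ℚ)) N P :=
      ⟨fun k => (h.nams k).toIsAdmissible, by positivity,
        h.tendsto_filling hm0 fun k => (hm k).2, h.pattern⟩
    exact ⟨⟨m, hm0, fun k => (hm k).1, hnu, hcf, fun hN => ⟨hnu, hN, hcf⟩⟩, fun k a ha =>
      (h.nams k).S_reflection hn (h.nams k).pos (h.nams k).dvd (hm k).1 (hm k).2 ha⟩
  -- For `n = 0` the filling fraction would be zero, which is excluded.
  · have hn : 0 < n := by
      rw [Nat.pos_iff_ne_zero]
      rintro rfl
      simpa using h.pos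
    exact (h.clusterForm k).isNAMS hk hn (h.card_eq k)
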